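/- Let $\mathcal H=L^2(\mathbb R)$, and let $Q$, $P$ be position and momentum, $(Q\psi)(x)=x\psi(x)$, $(P\psi)(x)=-i\psi'(x)$, acting on the Schwartz functions $\mathfrak S(\mathbb R)$. A bounded operator $T$ on $\mathcal H$ is a *Schwartz operator* if for all $\alpha,\alpha',\beta,\beta'\in\mathbb N_0$ $$\|T\|_{\alpha,\alpha',\beta,\beta'}:=\sup\{|\langle P^\beta Q^\alpha\psi\,|\,T P^{\beta'}Q^{\alpha'}\varphi\rangle| : \psi,\varphi\in\mathfrak S(\mathbb R),\ \|\psi\|\le1,\ \|\varphi\|\le1\}<\infty .$$ Let $\mathcal S(\mathcal H)$ be the space of Schwartz operators with the topology generated by these seminorms, and let $\mathcal S'(\mathcal H)$ be its topological dual with the weak-* topology. For $M\in\mathbb N$ let $\mathcal K_M=(\mathbb C^2)^{\otimes M}_+$ be the symmetric tensor product, with symmetrizer $S_M$ and number basis $|n;M\rangle=\binom Mn^{1/2}S_M\,|0\rangle^{\otimes(M-n)}\otimes|1\rangle^{\otimes n}$, $0\le n\le M$. For a $2\times2$ matrix $a$ and $\vartheta=|0\rangle\langle0|$ let $$F_M(a)=\frac1{\sqrt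 M}\sum_{j=1}^M\bigl(a^{(j)}-\mathrm{Tr}(a\vartheta)\mathbb 1\bigr),\qquad a^{(j)}=\mathbb 1^{\otimes(j-1)}\otimes a\otimes\mathbb 1^{\otimes(M-j)},$$ restricted to $\mathcal K_M$. With the Pauli matrices $\sigma_1,\sigma_2$, put $Q_M=F_M(\sigma_1/\sqrt2)$ and $P_M=F_M(\sigma_2/\sqrt2)$. Embed $\mathcal K_M$ isometrically into $\mathcal H$ by mapping $|n;M\rangle$ to the $n$-th normalized Hermite function $h_n$, and regard $Q_M,P_M$ as finite rank operators on $\mathcal H$, equal to $0$ on the orthogonal complement of $\mathrm{span}\{h_0,\dots,h_M\}$. Let $f$ be any polynomial with complex coefficients in two non-commuting variables. Then: 1. For every $T\in\mathcal S(\mathcal H)$, $T$ maps $\mathcal H$ into $\mathfrak S(\mathbb R)$, the operator $f(Q,P)T$ is bounded and trace class on $\mathcal H$, and $f(Q_M,P_M)T$ is trace class for every $M$. 2. $T\mapsto\mathrm{Tr}(f(Q,P)T)$ and, for each $M$, $T\mapsto\mathrm{Tr}(f(Q_M,P_M)T)$ are elements of $\mathcal S'(\mathcal H)$. 3. The sequence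 $f(Q_M,P_M)$ converges in $\mathcal S'(\mathcal H)$ to $f(Q,P)$ as $M\to\infty$, i.e. $$\lim_{M\to\infty}\mathrm{Tr}(f(Q_M,P_M)T)=\mathrm{Tr}(f(Q,P)T)\qquad\text{for all }T\in\mathcal S(\mathcal H).$$ -/

import Mathlib

open MeasureTheory Filter Topology
open scoped SchwartzMap InnerProductSpace InnerProduct

noncomputable section

namespace FluctuationOperators

/-! ### Trace class operators and the trace -/

section Trace

variable {E : Type*} [NormedAddCommGroup E] [InnerProductSpace ℂ E] [CompleteSpace E]

variable (E) in
/-- The index set of some fixed orthonormal (Hilbert) basis of `E`. -/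
def onbIndex : Set E := Classical.choose (exists_hilbertBasis ℂ E)

variable (E) in
/-- A fixed orthonormal (Hilbert) basis of `E`. Neither the notion of trace class operator
nor the trace of a trace class operator depends on which basis is used. -/
def onb : HilbertBasis (onbIndex E) ℂ E :=
  Classical.choose (Classical.choose_spec (exists_hilbertBasis ℂ E))

/-- `A` is trace class: `Tr |A| < ∞`, where `|A| = (A* A)^{1/2}`. -/
def IsTraceClass (A : E →L[ℂ] E) : Prop :=
  Summable fun i : onbIndex E => (⟪onb E i, CFC.abs A (onb E i)⟫_ℂ).re

/-- The trace `Tr A = ∑ i, ⟨e i, A e i⟩` (meaningful for trace class `A`). -/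
def trace (A : E →L[ℂ] E) : ℂ :=
  ∑' i : onbIndex E, ⟪onb E i, A (onb E i)⟫_ℂ

end Trace

/-! ### Position and momentum on `L²(ℝ)` -/

/-- The Hilbert space `L²(ℝ)` of complex-valued functions. -/
abbrev L2R : Type := Lp ℂ 2 (volume : Measure ℝ)

/-- The inclusion of the Schwartz space into `L²(ℝ)`. -/
abbrev incl : 𝓢(ℝ, ℂ) →L[ℂ] L2R := SchwartzMap.toLpCLM ℂ ℂ 2 volume

/-- The position operator `(Q ψ)(x) = x ψ(x)` on Schwartz functions. -/
def position : 𝓢(ℝ, ℂ) →L[ℂ] 𝓢(ℝ, ℂ) :=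
  SchwartzMap.smulLeftCLM ℂ (fun x : ℝ => (x : ℂ))

/-- The momentum operator `(P ψ)(x) = -i ψ'(x)` on Schwartz functions. -/
def momentum : 𝓢(ℝ, ℂ) →L[ℂ] 𝓢(ℝ, ℂ) :=
  (-Complex.I) • SchwartzMap.derivCLM ℂ ℂ

theorem hasTemperateGrowth_ofReal : (fun x : ℝ => (x : ℂ)).HasTemperateGrowth :=
  Complex.ofRealCLM.hasTemperateGrowth

theorem position_apply (ψ : 𝓢(ℝ, ℂ)) (x : ℝ) : position ψ x = (x : ℂ) * ψ x := by
  simp [position, SchwartzMap.smulLeftCLM_apply_apply hasTemperateGrowth_ofReal]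

theorem momentum_apply (ψ : 𝓢(ℝ, ℂ)) (x : ℝ) :
    momentum ψ x = -Complex.I * deriv ψ x := by
  simp [momentum]

/-- The evaluation `f(X, Y)` of a polynomial `f` in two non-commuting variables
(with complex coefficients) at two elements of a complex algebra. -/
def evalPoly {R : Type*} [Ring R] [Algebra ℂ R] (f : FreeAlgebra ℂ (Fin 2)) (X Y : R) : R :=
  FreeAlgebra.lift ℂ ![X, Y] f

/-! ### Hermite functions -/

theorem polynomial_mul_gaussian_bounded (p : Polynomial ℝ) :
    ∃ C, ∀ x : ℝ, |p.eval x| * Real.exp (-(x ^ 2 / 2)) ≤ C := by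
  induction p using Polynomial.induction_on' with
  | add p q hp hq =>
    obtain ⟨C, hC⟩ := hp
    obtain ⟨D, hD⟩ := hq
    refine ⟨C + D, fun x => ?_⟩
    rw [Polynomial.eval_add]
    calc |p.eval x + q.eval x| * Real.exp (-(x ^ 2 / 2))
        ≤ (|p.eval x| + |q.eval x|) * Real.exp (-(x ^ 2 / 2)) := by
          gcongr
          exact abs_add_le _ _
      _ ≤ C + D := by rw [add_mul]; exact add_le_add (hC x) (hD x)
  | monomial m c =>
    refine ⟨|c| * (m.factorial * Real.exp (1 / 2)), fun x => ?_⟩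
    rw [Polynomial.eval_monomial, abs_mul, abs_pow, mul_assoc]
    refine mul_le_mul_of_nonneg_left ?_ (abs_nonneg c)
    have h1 : |x| ^ m ≤ m.factorial * Real.exp |x| := by
      have h := Real.pow_div_factorial_le_exp |x| (abs_nonneg x) m
      rw [div_le_iff₀ (by positivity)] at h
      linarith
    have h2 : Real.exp |x| * Real.exp (-(x ^ 2 / 2)) ≤ Real.exp (1 / 2) := by
      rw [← Real.exp_add]
      refine Real.exp_le_exp.mpr ?_
      nlinarith [sq_nonneg (|x| - 1), sq_abs x]
    calc |x| ^ m * Real.exp (-(x ^ 2 / 2))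
        ≤ m.factorial * Real.exp |x| * Real.exp (-(x ^ 2 / 2)) := by gcongr
      _ ≤ m.factorial * Real.exp (1 / 2) := by
          rw [mul_assoc]
          gcongr

theorem gaussian_decay (k n : ℕ) :
    ∃ C, ∀ x : ℝ,
      ‖x‖ ^ k * ‖iteratedFDeriv ℝ n (fun y : ℝ => Real.exp (-(y ^ 2 / 2))) x‖ ≤ C := by
  obtain ⟨C, hC⟩ := polynomial_mul_gaussian_bounded
    (Polynomial.X ^ k * (Polynomial.hermite n).map (Int.castRingHom ℝ))
  refine ⟨C, fun x => le_trans (le_of_eq ?_) (hC x)⟩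
  rw [norm_iteratedFDeriv_eq_norm_iteratedDeriv, iteratedDeriv_eq_iterate,
    Polynomial.deriv_gaussian_eq_hermite_mul_gaussian]
  simp [Polynomial.aeval_def, Polynomial.eval_map, abs_mul, mul_assoc]

/-- The Gaussian `x ↦ exp (-x² / 2)` as a Schwartz function. -/
def gaussian : 𝓢(ℝ, ℂ) :=
  SchwartzMap.postcompCLM (𝕜 := ℝ) Complex.ofRealCLM
    { toFun := fun x : ℝ => Real.exp (-(x ^ 2 / 2))
      smooth' := by fun_prop
      decay' := gaussian_decay }

theorem gaussian_apply (x : ℝ) : gaussian x = (Real.exp (-(x ^ 2 / 2)) : ℂ) := by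
  change ((Real.exp (-(x ^ 2 / 2)) : ℝ) : ℂ) = _
  rfl

/-- The polynomial prefactor `(n! √π)^{-1/2} He_n(√2 x)` of the `n`-th Hermite function. Here
`He_n` is the probabilists' Hermite polynomial, so `He_n(√2 x) = 2^{-n/2} H_n(x)` with the
physicists' Hermite polynomial `H_n`. -/
def hermitePrefactor (n : ℕ) (x : ℝ) : ℝ :=
  (Real.sqrt (n.factorial * Real.sqrt Real.pi))⁻¹ *
    Polynomial.aeval (Real.sqrt 2 * x) (Polynomial.hermite n)

theorem polynomial_hasTemperateGrowth (p : Polynomial ℝ) :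
    (fun x : ℝ => p.eval x).HasTemperateGrowth := by
  induction p using Polynomial.induction_on' with
  | add p q hp hq => simpa only [Polynomial.eval_add] using! hp.add hq
  | monomial m c =>
    simpa only [Polynomial.eval_monomial] using!
      (Function.HasTemperateGrowth.const c).mul (Function.HasTemperateGrowth.id'.pow m)

theorem hermitePrefactor_hasTemperateGrowth (n : ℕ) :
    (fun x : ℝ => (hermitePrefactor n x : ℂ)).HasTemperateGrowth := by
  have h := polynomial_hasTemperateGrowth
    (Polynomial.C (Real.sqrt (n.factorial * Real.sqrt Real.pi))⁻¹ *
      ((Polynomial.hermite n).map (Int.castRingHom ℝ)).comp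
        (Polynomial.C (Real.sqrt 2) * Polynomial.X))
  refine hasTemperateGrowth_ofReal.comp (f := fun x : ℝ => hermitePrefactor n x) ?_
  convert h using 2 with x
  simp [hermitePrefactor, Polynomial.aeval_def, Polynomial.eval_map]

/-- The `n`-th Hermite function
`h_n(x) = (2^n n! √π)^{-1/2} H_n(x) exp (-x² / 2)` (`H_n` the physicists' Hermite polynomial),
as a Schwartz function. -/
def hermiteFun (n : ℕ) : 𝓢(ℝ, ℂ) :=
  SchwartzMap.smulLeftCLM ℂ (fun x : ℝ => (hermitePrefactor n x : ℂ)) gaussian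

theorem hermiteFun_apply (n : ℕ) (x : ℝ) :
    hermiteFun n x = (((Real.sqrt (n.factorial * Real.sqrt Real.pi))⁻¹ *
      Polynomial.aeval (Real.sqrt 2 * x) (Polynomial.hermite n) *
        Real.exp (-(x ^ 2 / 2)) : ℝ) : ℂ) := by
  rw [hermiteFun, SchwartzMap.smulLeftCLM_apply_apply (hermitePrefactor_hasTemperateGrowth n),
    gaussian_apply, hermitePrefactor]
  push_cast
  simp

/-! ### Schwartz operators and tempered distributions on them -/

/-- The numbers `|⟨P^β Q^α ψ | T P^β' Q^α' φ⟩|` for Schwartz functions `ψ, φ` of `L²`-norm at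
most one; the multi-index is `k = (α, α', β, β')`. -/
def formValues (k : ℕ × ℕ × ℕ × ℕ) (T : L2R →L[ℂ] L2R) : Set ℝ :=
  {r | ∃ ψ φ : 𝓢(ℝ, ℂ), ‖incl ψ‖ ≤ 1 ∧ ‖incl φ‖ ≤ 1 ∧
    r = ‖⟪incl ((momentum ^ k.2.2.1 * position ^ k.1) ψ),
          T (incl ((momentum ^ k.2.2.2 * position ^ k.2.1) φ))⟫_ℂ‖}

/-- `T` is a Schwartz operator: `‖T‖_{α,α',β,β'} < ∞` for all `α, α', β, β'`. -/
def IsSchwartzOperator (T : L2R →L[ℂ] L2R) : Prop :=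
  ∀ k : ℕ × ℕ × ℕ × ℕ, BddAbove (formValues k T)

theorem zero_mem_formValues (k : ℕ × ℕ × ℕ × ℕ) (T : L2R →L[ℂ] L2R) :
    0 ∈ formValues k T := 
  ⟨0, 0, by rw [map_zero]; simp, by rw [map_zero]; simp, by simp only [map_zero]; simp⟩

theorem le_of_formValues_add {k : ℕ × ℕ × ℕ × ℕ} {S T : L2R →L[ℂ] L2R} {a b : ℝ}
    (ha : a ∈ upperBounds (formValues k S)) (hb : b ∈ upperBounds (formValues k T)) :
    a + b ∈ upperBounds (formValues k (S + T)) := by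
  rintro r ⟨ψ, φ, hψ, hφ, rfl⟩
  rw [add_apply, inner_add_right]
  exact (norm_add_le _ _).trans
    (add_le_add (ha ⟨ψ, φ, hψ, hφ, rfl⟩) (hb ⟨ψ, φ, hψ, hφ, rfl⟩))

theorem le_of_formValues_smul {k : ℕ × ℕ × ℕ × ℕ} {T : L2R →L[ℂ] L2R} {a : ℝ} (c : ℂ)
    (ha : a ∈ upperBounds (formValues k T)) :
    ‖c‖ * a ∈ upperBounds (formValues k (c • T)) := by
  rintro r ⟨ψ, φ, hψ, hφ, rfl⟩
  rw [smul_apply, inner_smul_right, norm_mul]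
  exact mul_le_mul_of_nonneg_left (ha ⟨ψ, φ, hψ, hφ, rfl⟩) (norm_nonneg c)

/-- The vector space of Schwartz operators, as a subspace of the bounded operators. -/
def schwartzSubmodule : Submodule ℂ (L2R →L[ℂ] L2R) where
  carrier := {T | IsSchwartzOperator T}
  zero_mem' := fun k => ⟨0, by rintro r ⟨ψ, φ, -, -, rfl⟩; simp⟩
  add_mem' := fun hS hT k => by
    obtain ⟨a, ha⟩ := hS k
    obtain ⟨b, hb⟩ := hT k
    exact ⟨a + b, le_of_formValues_add ha hb⟩
  smul_mem' := fun c T hT k => by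
    obtain ⟨a, ha⟩ := hT k
    exact ⟨‖c‖ * a, le_of_formValues_smul c ha⟩

/-- The space `𝓢(H)` of Schwartz operators on `H = L²(ℝ)`. It is a type of its own because its
topology is not the one induced by the operator norm. -/
def SchwartzOperator : Type := schwartzSubmodule

instance : AddCommGroup SchwartzOperator := inferInstanceAs (AddCommGroup schwartzSubmodule)

instance : Module ℂ SchwartzOperator := inferInstanceAs (Module ℂ schwartzSubmodule)

/-- The bounded operator on `L²(ℝ)` underlying a Schwartz operator. -/
def SchwartzOperator.toCLM : SchwartzOperator →ₗ[ℂ] (L2R →L[ℂ] L2R) :=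
  schwartzSubmodule.subtype

/-- The seminorm `‖T‖_{α,α',β,β'}`: the supremum of `|⟨P^β Q^α ψ | T P^β' Q^α' φ⟩|` over all
Schwartz functions `ψ, φ` with `‖ψ‖ ≤ 1` and `‖φ‖ ≤ 1`. -/
def schwartzOperatorSeminorm (k : ℕ × ℕ × ℕ × ℕ) : Seminorm ℂ SchwartzOperator :=
  Seminorm.ofSMulLE (fun T => sSup (formValues k T.toCLM))
    (by
      refine le_antisymm (csSup_le ⟨_, zero_mem_formValues k _⟩ ?_)
        (le_csSup ((0 : SchwartzOperator).2 k) (zero_mem_formValues k _))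
      rintro r ⟨ψ, φ, -, -, rfl⟩
      simp)
    (fun S T => by
      rw [map_add]
      exact csSup_le ⟨_, zero_mem_formValues k _⟩
        (le_of_formValues_add (fun _ h => le_csSup (S.2 k) h) (fun _ h => le_csSup (T.2 k) h)))
    (fun c T => by
      rw [map_smul]
      exact csSup_le ⟨_, zero_mem_formValues k _⟩
        (le_of_formValues_smul c (fun _ h => le_csSup (T.2 k) h)))

/-- The locally convex topology of `𝓢(H)`, generated by the seminorms `‖·‖_{α,α',β,β'}`. -/
instance : TopologicalSpace SchwartzOperator :=
  (SeminormFamily.moduleFilterBasis (𝕜 := ℂ) schwartzOperatorSeminorm).topology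

theorem withSeminorms_schwartzOperator :
    WithSeminorms (𝕜 := ℂ) schwartzOperatorSeminorm := ⟨rfl⟩

/-- The space `𝓢'(H)` of tempered distributions on `𝓢(H)`: continuous linear functionals on
`𝓢(H)`, with the weak-* topology. -/
abbrev TemperedOperatorDistribution : Type := WeakDual ℂ SchwartzOperator

/-! ### Fluctuation operators of `M` spins -/

/-- The `M`-fold tensor product `(ℂ²)^{⊗ M}`, written in the product basis: the entry of a
vector at `s : Fin M → Fin 2` is its coefficient at `|s 0⟩ ⊗ ⋯ ⊗ |s (M - 1)⟩`. -/
abbrev Spins (M : ℕ) : Type := EuclideanSpace ℂ (Fin M → Fin 2)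

/-- The elementary tensor `v 0 ⊗ ⋯ ⊗ v (M - 1)`. -/
def pureTensor {M : ℕ} (v : Fin M → Fin 2 → ℂ) : Spins M :=
  WithLp.toLp 2 fun s => ∏ j, v j (s j)

/-- The one-site operator `a^{(j)} = 1 ⊗ ⋯ ⊗ 1 ⊗ a ⊗ 1 ⊗ ⋯ ⊗ 1`, with `a` in the `j`-th
position. -/
def siteOp {M : ℕ} (j : Fin M) (a : Matrix (Fin 2) (Fin 2) ℂ) : Spins M →ₗ[ℂ] Spins M where
  toFun x := WithLp.toLp 2 fun s => ∑ c : Fin 2, a (s j) c * x (Function.update s j c)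
  map_add' x y := by
    ext s
    simp [mul_add, Finset.sum_add_distrib]
  map_smul' c x := by
    ext s
    simp [mul_add, mul_left_comm]

theorem siteOp_pureTensor {M : ℕ} (j : Fin M) (a : Matrix (Fin 2) (Fin 2) ℂ)
    (v : Fin M → Fin 2 → ℂ) :
    siteOp j a (pureTensor v) = pureTensor (Function.update v j (a.mulVec (v j))) := by
  ext s
  simp only [siteOp, pureTensor, LinearMap.coe_mk, AddHom.coe_mk]
  rw [← Finset.mul_prod_erase Finset.univ _ (Finset.mem_univ j)]
  have h : ∀ k ∈ Finset.univ.erase j,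
      Function.update v j (a.mulVec (v j)) k (s k) = v k (s k) := fun k hk => by
    rw [Function.update_of_ne (Finset.ne_of_mem_erase hk)]
  rw [Finset.prod_congr rfl h, Function.update_self, Matrix.mulVec, dotProduct, Finset.sum_mul]
  refine Finset.sum_congr rfl fun c _ => ?_
  rw [← Finset.mul_prod_erase Finset.univ _ (Finset.mem_univ j), Function.update_self, mul_assoc]
  congr 2
  refine Finset.prod_congr rfl fun k hk => ?_
  rw [Function.update_of_ne (Finset.ne_of_mem_erase hk)]

/-- The unitary that permutes the tensor factors by `π`. -/
def permute {M : ℕ} (π : Equiv.Perm (Fin M)) : Spins M →ₗ[ℂ] Spins M where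
  toFun x := WithLp.toLp 2 fun s => x (s ∘ π)
  map_add' _ _ := rfl
  map_smul' _ _ := rfl

/-- The symmetric tensor product `𝒦_M = (ℂ²)^{⊗ M}_+`. -/
def symSpins (M : ℕ) : Submodule ℂ (Spins M) where
  carrier := {x | ∀ π : Equiv.Perm (Fin M), permute π x = x}
  zero_mem' := fun π => map_zero _
  add_mem' := fun hx hy π => by rw [map_add, hx π, hy π]
  smul_mem' := fun c x hx π => by rw [map_smul, hx π]

/-- The symmetrizer `S_M`, the orthogonal projection of `(ℂ²)^{⊗ M}` onto `𝒦_M`. -/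
def symmetrizer (M : ℕ) : Spins M →ₗ[ℂ] Spins M :=
  ((M.factorial : ℂ)⁻¹) • ∑ π : Equiv.Perm (Fin M), permute π

/-- The number vector
`|n; M⟩ = (M choose n)^{1/2} S_M (|0⟩^{⊗ (M - n)} ⊗ |1⟩^{⊗ n})`, for `0 ≤ n ≤ M`. -/
def numberVec (M n : ℕ) : Spins M :=
  ((Real.sqrt (M.choose n) : ℝ) : ℂ) • symmetrizer M
    (pureTensor fun j : Fin M => if (j : ℕ) < M - n then Pi.single 0 1 else Pi.single 1 1)

/-- The fluctuation operator
`F_M(a) = M^{-1/2} ∑ j, (a^{(j)} - Tr(a ϑ))` with reference state `ϑ = |0⟩⟨0|`,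
on the whole tensor product. -/
def fluctFull (M : ℕ) (a : Matrix (Fin 2) (Fin 2) ℂ) : Spins M →ₗ[ℂ] Spins M :=
  (((Real.sqrt M)⁻¹ : ℝ) : ℂ) •
    ∑ j : Fin M, (siteOp j a - (a * Matrix.single 0 0 1).trace • LinearMap.id)

theorem permute_siteOp {M : ℕ} (a : Matrix (Fin 2) (Fin 2) ℂ) (π : Equiv.Perm (Fin M))
    (j : Fin M) (x : Spins M) : permute π (siteOp j a x) = siteOp (π j) a (permute π x) := by
  ext s
  change ∑ c : Fin 2, a (s (π j)) c * x (Function.update (s ∘ π) j c) =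
    ∑ c : Fin 2, a (s (π j)) c * x (Function.update s (π j) c ∘ π)
  refine Finset.sum_congr rfl fun c _ => ?_
  refine congrArg (fun t : Fin M → Fin 2 => a (s (π j)) c * x t) (funext fun k => ?_)
  by_cases h : k = j
  · simp [h]
  · simp [Function.update_of_ne h, Function.update_of_ne (π.injective.ne h)]

theorem fluctFull_permute {M : ℕ} (a : Matrix (Fin 2) (Fin 2) ℂ) (π : Equiv.Perm (Fin M))
    (x : Spins M) : permute π (fluctFull M a x) = fluctFull M a (permute π x) := by
  simp only [fluctFull, LinearMap.smul_apply, LinearMap.sum_apply, LinearMap.sub_apply,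
    LinearMap.id_apply, map_smul, map_sum, map_sub, permute_siteOp]
  congr 1
  exact Equiv.sum_comp π fun j : Fin M =>
    siteOp j a (permute π x) - (a * Matrix.single 0 0 1).trace • permute π x

theorem fluctFull_mem {M : ℕ} (a : Matrix (Fin 2) (Fin 2) ℂ) (x : Spins M)
    (hx : x ∈ symSpins M) : fluctFull M a x ∈ symSpins M := fun π => by
  rw [fluctFull_permute, hx π]

/-- The fluctuation operator `F_M(a)` on the symmetric tensor product `𝒦_M`. -/
def fluct (M : ℕ) (a : Matrix (Fin 2) (Fin 2) ℂ) : symSpins M →ₗ[ℂ] symSpins M :=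
  (fluctFull M a).restrict (fluctFull_mem a)

/-- The first Pauli matrix. -/
def pauli1 : Matrix (Fin 2) (Fin 2) ℂ := !![0, 1; 1, 0]

/-- The second Pauli matrix. -/
def pauli2 : Matrix (Fin 2) (Fin 2) ℂ := !![0, -Complex.I; Complex.I, 0]

/-- The embedding of `𝒦_M` into `L²(ℝ)` which sends `|n; M⟩` to the Hermite function `h_n`:
`x ↦ ∑ n ≤ M, ⟨n; M | x⟩ h_n`. -/
def embed (M : ℕ) : symSpins M →L[ℂ] L2R :=
  ∑ n ∈ Finset.range (M + 1),
    ((innerSL ℂ (numberVec M n)).comp (symSpins M).subtypeL).smulRight (incl (hermiteFun n))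

/-- An operator on `𝒦_M` as a finite rank operator on `L²(ℝ)`, through the embedding `embed`:
it acts on the image of `𝒦_M` and vanishes on the orthogonal complement. -/
def embedOp (M : ℕ) (X : symSpins M →ₗ[ℂ] symSpins M) : L2R →L[ℂ] L2R :=
  embed M ∘L LinearMap.toContinuousLinearMap X ∘L
    ContinuousLinearMap.adjoint (𝕜 := ℂ) (E := symSpins M) (F := L2R) (embed M)

/-- `Q_M = F_M(σ₁ / √2)`, as an operator on `L²(ℝ)`. -/
def fluctQ (M : ℕ) : L2R →L[ℂ] L2R :=
  embedOp M (fluct M ((((Real.sqrt 2)⁻¹ : ℝ) : ℂ) • pauli1))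

/-- `P_M = F_M(σ₂ / √2)`, as an operator on `L²(ℝ)`. -/
def fluctP (M : ℕ) : L2R →L[ℂ] L2R :=
  embedOp M (fluct M ((((Real.sqrt 2)⁻¹ : ℝ) : ℂ) • pauli2))

/-- `B = f(Q, P) T`: for every `φ`, the vector `T φ` is a Schwartz function, and `f(Q, P)`
maps it to `B φ`. -/
def IsPolyMul (f : FreeAlgebra ℂ (Fin 2)) (T B : L2R →L[ℂ] L2R) : Prop :=
  ∀ φ : L2R, ∃ η : 𝓢(ℝ, ℂ), incl η = T φ ∧ incl (evalPoly f position momentum η) = B φ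

end FluctuationOperators

end

open FluctuationOperators

noncomputable section

namespace FluctuationOperators

/-! ### Trace class operators from absolutely convergent sums of rank one operators -/

section TraceClass

variable {E : Type*} [NormedAddCommGroup E] [InnerProductSpace ℂ E] [CompleteSpace E]

/-! In the Hermite basis `Q` and `P` are ladder operators `e n ↦ q √(n+1) e (n+1) + p √n e (n-1)`,
and `Q_M`, `P_M` are ladder operators with the same `p`, `q`, where `√n` is replaced by `√n
√((M+1-n)/M)` (`fluctQ_hermiteFun`, `fluctP_hermiteFun`). The new weights vanish for `n > M`, so the
cutoff takes care of itself; they are at most `√n`, and for fixed `n` they tend to `√n`. Both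
properties survive sums and products of operators (`TameTendsto`). Hence `f(Q_M, P_M) h_n → f(Q, P)
h_n` for each `n`, with a bound `C (n+1)^t` uniform in `M`.

A Schwartz operator is `T = ∑ |h_n⟩⟨T* h_n|`, and `‖T* h_n‖` decays faster than any power of `n`
(`exists_bound_adjointHermite`): with `H = (P² + Q² + 1)/2` one has `H^k h_n = (n+1)^k h_n`, and
`H^k` is a combination of normally ordered monomials `P^β Q^α`, which the seminorms of `T` control.

Multiplying by a polynomial therefore gives an absolutely convergent series `∑ |v_n⟩⟨T* h_n|` with
`v_n` polynomially bounded. Such a series is trace class with trace `∑ ⟨T* h_n, v_n⟩`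
(`isTraceClass_of_hasSum`, `trace_eq_tsum`). The decay estimate makes this trace continuous in `T`,
and dominated convergence over `n` gives the limit. Since the Schwartz seminorms of `h_n` grow
polynomially, the expansion of `T φ` also converges in the Schwartz space, where `f(Q, P)` is
continuous and may be applied term by term. -/

theorem isPositive_abs (A : E →L[ℂ] E) : (CFC.abs A).IsPositive :=
  (ContinuousLinearMap.nonneg_iff_isPositive _).mp (CFC.abs_nonneg A)

theorem inner_abs_left (A : E →L[ℂ] E) (x y : E) : ⟪CFC.abs A x, y⟫_ℂ = ⟪x, CFC.abs A y⟫_ℂ :=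
  (isPositive_abs A).isSymmetric x y

theorem inner_abs_abs (A : E →L[ℂ] E) (x y : E) :
    ⟪CFC.abs A x, CFC.abs A y⟫_ℂ = ⟪A x, A y⟫_ℂ := by
  rw [inner_abs_left, ← mul_apply_eq_comp, CFC.abs_mul_abs,
    ContinuousLinearMap.star_eq_adjoint, mul_apply_eq_comp,
    ContinuousLinearMap.adjoint_inner_right]

theorem norm_abs_apply (A : E →L[ℂ] E) (x : E) : ‖CFC.abs A x‖ = ‖A x‖ := by
  rw [@norm_eq_sqrt_re_inner ℂ, @norm_eq_sqrt_re_inner ℂ E _ _ _ (A x), inner_abs_abs]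

/-- Since `|A| ≥ 0`, the sum dominates the strictly positive scalar `ε`. -/
theorem isUnit_abs_add_smul (A : E →L[ℂ] E) {ε : ℝ} (hε : 0 < ε) :
    IsUnit (CFC.abs A + algebraMap ℝ (E →L[ℂ] E) ε) := by
  rcases subsingleton_or_nontrivial E with h | h
  · have : Subsingleton (E →L[ℂ] E) := inferInstance
    exact isUnit_of_subsingleton _
  refine CStarAlgebra.isUnit_of_le (algebraMap ℝ (E →L[ℂ] E) ε)
    (le_add_of_nonneg_left (CFC.abs_nonneg A)) ?_
  exact IsStrictlyPositive.iff_of_unital.mpr ⟨by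
    simpa using (algebraMap_nonneg (E →L[ℂ] E) hε.le),
    (IsUnit.mk0 ε hε.ne').map _⟩

/-- An approximate polar decomposition: `|A|` is within `ε` of `W* A` for a contraction `W`. -/
theorem exists_contraction_abs (A : E →L[ℂ] E) {ε : ℝ} (hε : 0 < ε) :
    ∃ W : E →L[ℂ] E, ‖W‖ ≤ 1 ∧
      ∀ x, (⟪x, CFC.abs A x⟫_ℂ).re ≤ ‖⟪W x, A x⟫_ℂ‖ + ε * ‖x‖ ^ 2 := by
  obtain ⟨u, hu⟩ := isUnit_abs_add_smul A hε
  set R : E →L[ℂ] E := ↑u⁻¹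
  -- With `R = (|A| + ε)⁻¹`, every vector splits as `x = |A| R x + ε R x`. Both remaining estimates
  -- are obtained by substituting this for `x`.
  have hR : ∀ x, CFC.abs A (R x) + ε • R x = x := fun x => by
    have h : (u : E →L[ℂ] E) * R = 1 := u.mul_inv
    have := congrArg (fun B : E →L[ℂ] E => B x) h
    rw [hu] at this
    simpa [Algebra.algebraMap_eq_smul_one] using this
  have hB : ∀ x, ‖CFC.abs A (R x)‖ ≤ ‖x‖ := fun x => by
    have h1 : 0 ≤ (⟪CFC.abs A (R x), R x⟫_ℂ).re := (isPositive_abs A).re_inner_nonneg_left (R x)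
    -- The cross term is nonnegative because `|A|` is positive, so `|A| R` is a contraction.
    have h2 : ‖x‖ ^ 2 = ‖CFC.abs A (R x)‖ ^ 2 + 2 * (ε * (⟪CFC.abs A (R x), R x⟫_ℂ).re) +
        ‖ε • R x‖ ^ 2 := by
      conv_lhs => rw [← hR x]
      rw [@norm_add_sq ℂ, RCLike.real_smul_eq_coe_smul (K := ℂ), inner_smul_right]
      simp
    refine le_of_sq_le_sq ?_ (norm_nonneg x) 
    nlinarith [mul_nonneg hε.le h1, sq_nonneg ‖ε • R x‖]
  -- `W = A R` has the same norms as `|A| R`, because `‖A y‖ = ‖|A| y‖`.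
  refine ⟨A * R, ContinuousLinearMap.opNorm_le_bound _ zero_le_one fun x => ?_, fun x => ?_⟩
  · rw [mul_apply_eq_comp, ← norm_abs_apply, one_mul]
    exact hB x
  · have h : ⟪x, CFC.abs A x⟫_ℂ = ⟪A (R x), A x⟫_ℂ + ε * ⟪CFC.abs A (R x), x⟫_ℂ := by
      conv_lhs => rw [← hR x, inner_add_left, hR x, RCLike.real_smul_eq_coe_smul (K := ℂ),
        inner_smul_left, inner_abs_abs, ← inner_abs_left]
      simp
    rw [h, Complex.add_re]
    refine add_le_add (Complex.re_le_norm _) ((Complex.re_le_norm _).trans ?_)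
    rw [norm_mul, Complex.norm_real, Real.norm_of_nonneg hε.le]
    refine mul_le_mul_of_nonneg_left ((norm_inner_le_norm _ _).trans ?_) hε.le
    rw [sq]
    exact mul_le_mul_of_nonneg_right (hB x) (norm_nonneg x)

omit [CompleteSpace E] in
-- Cauchy–Schwarz for finite sums, then Bessel's inequality for each factor.
theorem sum_norm_inner_mul_inner_le {ι : Type*} {e : ι → E} (he : Orthonormal ℂ e) (x y : E)
    (s : Finset ι) : ∑ i ∈ s, ‖⟪x, e i⟫_ℂ‖ * ‖⟪e i, y⟫_ℂ‖ ≤ ‖x‖ * ‖y‖ := by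
  refine (Real.sum_mul_le_sqrt_mul_sqrt s _ _).trans (mul_le_mul ?_ ?_ (Real.sqrt_nonneg _)
    (norm_nonneg x))
  · refine Real.sqrt_le_iff.mpr ⟨norm_nonneg x, ?_⟩
    simp_rw [norm_inner_symm x]
    exact he.sum_inner_products_le x
  · exact Real.sqrt_le_iff.mpr ⟨norm_nonneg y, he.sum_inner_products_le y⟩

variable {A : E →L[ℂ] E} {u v : ℕ → E}

/-- Replace `|A|` by `W* A` up to a small error, expand `A` into rank one terms and exchange the
sums: for each `m`, Bessel bounds the sum over the orthonormal basis by `‖u m‖ ‖v m‖`. -/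
theorem isTraceClass_of_hasSum (huv : Summable fun m => ‖u m‖ * ‖v m‖)
    (hA : ∀ x, HasSum (fun m => ⟪u m, x⟫_ℂ • v m) (A x)) : IsTraceClass A := by
  refine summable_of_sum_le (c := ∑' m, ‖u m‖ * ‖v m‖)
    (fun i => (isPositive_abs A).re_inner_nonneg_right _) fun s => ?_
  refine le_of_forall_pos_le_add fun δ hδ => ?_
  -- The error `ε` is incurred once for each index in `s`; this choice keeps the total below `δ`,
  -- and the `+ 1` covers empty `s`.
  obtain ⟨W, hW, hWA⟩ := exists_contraction_abs A (ε := δ / (s.card + 1)) (by positivity)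
  have he : Orthonormal ℂ (onb E) := (onb E).orthonormal
  have hx : ∀ x, HasSum (fun m => ⟪u m, x⟫_ℂ * ⟪W x, v m⟫_ℂ) ⟪W x, A x⟫_ℂ := fun x => by
    simpa [inner_smul_right] using (innerSL ℂ (W x)).hasSum (hA x)
  have hb : ∀ x m, ‖⟪u m, x⟫_ℂ * ⟪W x, v m⟫_ℂ‖ =
      ‖⟪u m, x⟫_ℂ‖ * ‖⟪x, ContinuousLinearMap.adjoint W (v m)⟫_ℂ‖ := fun x m => by
    rw [norm_mul, ContinuousLinearMap.adjoint_inner_right]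
  have hs : ∀ i ∈ s, Summable fun m => ‖⟪u m, onb E i⟫_ℂ * ⟪W (onb E i), v m⟫_ℂ‖ := fun i _ => by
    refine huv.of_nonneg_of_le (fun _ => norm_nonneg _) fun m => ?_
    rw [norm_mul]
    refine mul_le_mul ?_ ?_ (norm_nonneg _) (norm_nonneg _)
    · simpa [he.1 i] using norm_inner_le_norm (𝕜 := ℂ) (u m) (onb E i)
    · refine (norm_inner_le_norm _ _).trans ?_
      refine mul_le_of_le_one_left (norm_nonneg _) ((W.le_opNorm _).trans ?_)
      rwa [he.1 i, mul_one]
  calc ∑ i ∈ s, (⟪onb E i, CFC.abs A (onb E i)⟫_ℂ).re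
      ≤ ∑ i ∈ s, (∑' m, ‖⟪u m, onb E i⟫_ℂ * ⟪W (onb E i), v m⟫_ℂ‖ + δ / (s.card + 1)) := by
        refine Finset.sum_le_sum fun i hi => (hWA _).trans ?_
        rw [he.1 i, one_pow, mul_one, ← (hx _).tsum_eq]
        exact add_le_add_left (norm_tsum_le_tsum_norm (hs i hi)) _
    _ = ∑' m, ∑ i ∈ s, ‖⟪u m, onb E i⟫_ℂ * ⟪W (onb E i), v m⟫_ℂ‖ +
          s.card * (δ / (s.card + 1)) := by
        rw [Finset.sum_add_distrib, Summable.tsum_finsetSum hs]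
        simp
    _ ≤ ∑' m, ‖u m‖ * ‖v m‖ + δ := by
        refine add_le_add (Summable.tsum_le_tsum (fun m => ?_) (summable_sum hs) huv) ?_
        · simp_rw [hb]
          refine (sum_norm_inner_mul_inner_le he _ _ s).trans
            (mul_le_mul_of_nonneg_left ?_ (norm_nonneg _))
          refine (ContinuousLinearMap.le_opNorm _ _).trans
            (mul_le_of_le_one_left (norm_nonneg _) ?_)
          rwa [LinearIsometryEquiv.norm_map]
        · rw [mul_div_assoc', div_le_iff₀ (by positivity)]
          nlinarith

/-- Bessel makes the double series over `m` and the basis absolutely summable. After the exchange,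
Parseval evaluates the sum over the basis. -/
theorem trace_eq_tsum (huv : Summable fun m => ‖u m‖ * ‖v m‖)
    (hA : ∀ x, HasSum (fun m => ⟪u m, x⟫_ℂ • v m) (A x)) :
    trace A = ∑' m, ⟪u m, v m⟫_ℂ := by
  have he : Orthonormal ℂ (onb E) := (onb E).orthonormal
  have hx : ∀ i, ⟪onb E i, A (onb E i)⟫_ℂ =
      ∑' m, ⟪u m, onb E i⟫_ℂ * ⟪onb E i, v m⟫_ℂ := fun i => by
    have := (innerSL ℂ (onb E i)).hasSum (hA (onb E i))
    simpa [inner_smul_right] using this.tsum_eq.symm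
  have hb : ∀ m (s : Finset (onbIndex E)),
      ∑ i ∈ s, ‖⟪u m, onb E i⟫_ℂ * ⟪onb E i, v m⟫_ℂ‖ ≤ ‖u m‖ * ‖v m‖ := fun m s => by
    simp_rw [norm_mul]
    exact sum_norm_inner_mul_inner_le he _ _ s
  have hm : ∀ m, Summable fun i => ‖⟪u m, onb E i⟫_ℂ * ⟪onb E i, v m⟫_ℂ‖ := fun m =>
    summable_of_sum_le (fun _ => norm_nonneg _) (hb m)
  have hsum : Summable (Function.uncurry fun (m : ℕ) (i : onbIndex E) =>
      ⟪u m, onb E i⟫_ℂ * ⟪onb E i, v m⟫_ℂ) := by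
    refine Summable.of_norm ((summable_prod_of_nonneg fun _ => norm_nonneg _).mpr ⟨hm, ?_⟩)
    exact huv.of_nonneg_of_le (fun m => tsum_nonneg fun _ => norm_nonneg _)
      fun m => (hm m).tsum_le_of_sum_le (hb m)
  rw [trace]
  simp_rw [hx]
  rw [Summable.tsum_comm hsum]
  exact tsum_congr fun m => (onb E).tsum_inner_mul_inner (u m) (v m)

/-- The operator `∑ m, |v m⟩⟨u m|`. -/
theorem exists_clm_hasSum_rankOne (huv : Summable fun m => ‖u m‖ * ‖v m‖) :
    ∃ A : E →L[ℂ] E, ∀ x, HasSum (fun m => ⟪u m, x⟫_ℂ • v m) (A x) := by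
  have h : Summable fun m => (innerSL ℂ (u m)).smulRight (v m) := by
    refine Summable.of_norm (huv.congr fun m => ?_)
    rw [ContinuousLinearMap.norm_smulRight_apply, innerSL_apply_norm]
  refine ⟨∑' m, (innerSL ℂ (u m)).smulRight (v m), fun x => ?_⟩
  simpa using (ContinuousLinearMap.apply ℂ E x).hasSum h.hasSum

end TraceClass

/-! ### Hermite functions and the harmonic oscillator -/

section Hermite

/-- Induction on `He_{n+1} = X He_n - He_n'`. Inserted back into this recursion, the formula turns
it into the three-term recurrence, from which the ladder structure comes. -/
theorem derivative_hermite_succ (n : ℕ) :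
    Polynomial.derivative (Polynomial.hermite (n + 1)) =
      ((n + 1 : ℕ) : Polynomial ℤ) * Polynomial.hermite n := by
  induction n with
  | zero => simp [Polynomial.hermite_succ]
  | succ n ih =>
    rw [Polynomial.hermite_succ (n + 1), Polynomial.derivative_sub, Polynomial.derivative_mul, ih,
      Polynomial.derivative_mul, Polynomial.derivative_natCast, Polynomial.derivative_X]
    have h := Polynomial.hermite_succ n
    push_cast
    linear_combination -(n + 1 : Polynomial ℤ) * h

/-- The truncated `n - 1` is harmless at `n = 0`, where the factor `n` vanishes. The same convention
is used below for all lowering terms. -/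
theorem derivative_hermite (n : ℕ) :
    Polynomial.derivative (Polynomial.hermite n) =
      (n : Polynomial ℤ) * Polynomial.hermite (n - 1) := by
  cases n with
  | zero => simp
  | succ n => exact derivative_hermite_succ n

/-- The constant `1 / √2`. -/
def invSqrtTwo : ℂ := (((Real.sqrt 2)⁻¹ : ℝ) : ℂ)

theorem invSqrtTwo_mul_self : invSqrtTwo * invSqrtTwo = 1 / 2 := by
  rw [invSqrtTwo, ← Complex.ofReal_mul, ← mul_inv, Real.mul_self_sqrt zero_le_two]
  norm_num

theorem conj_invSqrtTwo : (starRingEnd ℂ) invSqrtTwo = invSqrtTwo := Complex.conj_ofReal _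

theorem norm_invSqrtTwo_le_one : ‖invSqrtTwo‖ ≤ 1 := by
  rw [invSqrtTwo, Complex.norm_real, norm_inv, Real.norm_of_nonneg (Real.sqrt_nonneg 2)]
  exact inv_le_one_of_one_le₀ (Real.one_le_sqrt.mpr one_le_two)

/-- The values of the Hermite functions, as real numbers. -/
def hermiteReal (n : ℕ) (x : ℝ) : ℝ :=
  (Real.sqrt (n.factorial * Real.sqrt Real.pi))⁻¹ *
    Polynomial.aeval (Real.sqrt 2 * x) (Polynomial.hermite n) * Real.exp (-(x ^ 2 / 2))

theorem sqrt_factorial_succ (n : ℕ) :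
    (Real.sqrt (n.factorial * Real.sqrt Real.pi))⁻¹ =
      Real.sqrt ((n : ℝ) + 1) *
        (Real.sqrt ((n + 1).factorial * Real.sqrt Real.pi))⁻¹ := by
  have h : Real.sqrt ((n : ℝ) + 1) ≠ 0 := by positivity
  have h' : ((n + 1).factorial : ℝ) * Real.sqrt Real.pi =
      ((n : ℝ) + 1) * (n.factorial * Real.sqrt Real.pi) := by
    rw [Nat.factorial_succ]
    push_cast
    ring
  rw [h', Real.sqrt_mul (by positivity : (0 : ℝ) ≤ n + 1), mul_inv, ← mul_assoc,
    mul_inv_cancel₀ h, one_mul]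

/-- The identity `n / √n! = √n / √(n-1)!`, carrying a factor `y (n - 1)` so that `n = 0` needs no
separate treatment in the recurrences. -/
theorem natCast_mul_sqrt_factorial (n : ℕ) (y : ℕ → ℝ) :
    (Real.sqrt (n.factorial * Real.sqrt Real.pi))⁻¹ * ((n : ℝ) * y (n - 1)) =
      Real.sqrt n * ((Real.sqrt ((n - 1).factorial * Real.sqrt Real.pi))⁻¹ * y (n - 1)) := by
  cases n with
  | zero => simp
  | succ n =>
    have h : Real.sqrt ((n : ℝ) + 1) * Real.sqrt ((n : ℝ) + 1) = n + 1 :=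
      Real.mul_self_sqrt (by positivity)
    rw [Nat.add_sub_cancel, sqrt_factorial_succ n, Nat.cast_succ]
    linear_combination -(Real.sqrt ((n + 1).factorial * Real.sqrt Real.pi))⁻¹ * y n * h

/-- The three-term recurrence of the Hermite polynomials after normalization. -/
theorem mul_hermiteReal (n : ℕ) (x : ℝ) :
    Real.sqrt 2 * x * hermiteReal n x =
      Real.sqrt ((n : ℝ) + 1) * hermiteReal (n + 1) x + Real.sqrt n * hermiteReal (n - 1) x := by
  have h1 := natCast_mul_sqrt_factorial n
    fun k => Polynomial.aeval (Real.sqrt 2 * x) (Polynomial.hermite k)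
  have h2 := sqrt_factorial_succ n
  simp only [hermiteReal, Polynomial.hermite_succ, derivative_hermite, map_sub, map_mul,
    Polynomial.aeval_X, map_natCast] at h1 h2 ⊢
  rw [h2] at h1 ⊢
  linear_combination Real.exp (-(x ^ 2 / 2)) * h1

theorem hasDerivAt_hermiteReal (n : ℕ) (x : ℝ) :
    HasDerivAt (hermiteReal n)
      ((Real.sqrt 2)⁻¹ * (Real.sqrt n * hermiteReal (n - 1) x -
        Real.sqrt ((n : ℝ) + 1) * hermiteReal (n + 1) x)) x := by
  have h1 : HasDerivAt (fun y : ℝ => Real.sqrt 2 * y) (Real.sqrt 2) x := by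
    simpa using (hasDerivAt_id x).const_mul (Real.sqrt 2)
  have h2 := ((Polynomial.hermite n).hasDerivAt_aeval (Real.sqrt 2 * x)).comp x h1
  have h3 : HasDerivAt (fun y : ℝ => -(y ^ 2 / 2)) (-x) x := by
    exact ((hasDerivAt_pow 2 x).div_const 2).neg.congr_deriv (by simp)
  have h4 := (h2.const_mul (Real.sqrt (n.factorial * Real.sqrt Real.pi))⁻¹).mul h3.exp
  refine h4.congr_deriv ?_
  have h5 := mul_hermiteReal n x
  have h6 := natCast_mul_sqrt_factorial n
    fun k => Polynomial.aeval (Real.sqrt 2 * x) (Polynomial.hermite k)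
  have h7 : (Real.sqrt 2)⁻¹ * Real.sqrt 2 = 1 := inv_mul_cancel₀ (by positivity)
  have h8 : Real.sqrt 2 = 2 * (Real.sqrt 2)⁻¹ := by
    field_simp
    simp
  rw [derivative_hermite, map_mul, map_natCast]
  -- Eliminating `h_{n+1}` leaves only the polynomials of index `n` and `n - 1`, which are the ones
  -- the product rule produces.
  have h9 : Real.sqrt ((n : ℝ) + 1) * hermiteReal (n + 1) x =
    Real.sqrt 2 * x * hermiteReal n x - Real.sqrt n * hermiteReal (n - 1) x := by linarith
  rw [h9]
  simp only [Function.comp_apply]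
  unfold hermiteReal at *
  linear_combination Real.sqrt 2 * Real.exp (-(x ^ 2 / 2)) * h6 +
    x * (Real.sqrt (n.factorial * Real.sqrt Real.pi))⁻¹ *
    Polynomial.aeval (Real.sqrt 2 * x) (Polynomial.hermite n) * Real.exp (-(x ^ 2 / 2)) * h7 +
    Real.exp (-(x ^ 2 / 2)) * (Real.sqrt n *
      ((Real.sqrt ((n - 1).factorial * Real.sqrt Real.pi))⁻¹ *
        Polynomial.aeval (Real.sqrt 2 * x) (Polynomial.hermite (n - 1)))) * h8

theorem hermiteFun_eq (n : ℕ) (x : ℝ) : hermiteFun n x = (hermiteReal n x : ℂ) :=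
  hermiteFun_apply n x

theorem deriv_hermiteFun (n : ℕ) (x : ℝ) : deriv (hermiteFun n) x =
    (((Real.sqrt 2)⁻¹ * (Real.sqrt n * hermiteReal (n - 1) x -
        Real.sqrt ((n : ℝ) + 1) * hermiteReal (n + 1) x) : ℝ) : ℂ) := by
  have : (hermiteFun n : ℝ → ℂ) = fun y => (hermiteReal n y : ℂ) := funext (hermiteFun_eq n)
  rw [this]
  exact (hasDerivAt_hermiteReal n x).ofReal_comp.deriv

theorem position_hermiteFun (n : ℕ) : position (hermiteFun n) =
    (invSqrtTwo * (Real.sqrt ((n + 1 : ℕ) : ℝ) : ℂ)) • hermiteFun (n + 1) +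
      (invSqrtTwo * (Real.sqrt n : ℂ)) • hermiteFun (n - 1) := by
  ext x
  have h := mul_hermiteReal n x
  have h7 : (Real.sqrt 2)⁻¹ * Real.sqrt 2 = 1 := inv_mul_cancel₀ (by positivity)
  rw [position_apply, add_apply, smul_apply, smul_apply, hermiteFun_eq, hermiteFun_eq,
    hermiteFun_eq, invSqrtTwo]
  simp only [smul_eq_mul]
  norm_cast
  push_cast
  linear_combination (Real.sqrt 2)⁻¹ * h - x * hermiteReal n x * h7

theorem momentum_hermiteFun (n : ℕ) : momentum (hermiteFun n) =
    (Complex.I * invSqrtTwo * (Real.sqrt ((n + 1 : ℕ) : ℝ) : ℂ)) • hermiteFun (n + 1) +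
      (-Complex.I * invSqrtTwo * (Real.sqrt n : ℂ)) • hermiteFun (n - 1) := by
  ext x
  rw [momentum_apply, add_apply, smul_apply, smul_apply, hermiteFun_eq, hermiteFun_eq,
    deriv_hermiteFun, invSqrtTwo]
  push_cast
  simp only [smul_eq_mul]
  ring

/-! ### Symmetry of `Q`, `P` and the oscillator; orthonormality of the Hermite functions -/

theorem inner_incl (ψ φ : 𝓢(ℝ, ℂ)) : ⟪incl ψ, incl φ⟫_ℂ = ∫ x, (starRingEnd ℂ) (ψ x) * φ x := by
  refine (SchwartzMap.inner_toL2_toL2_eq ψ φ volume).trans ?_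
  simp [mul_comm]

/-- Complex conjugation on Schwartz functions. -/
def conjSchwartz (ψ : 𝓢(ℝ, ℂ)) : 𝓢(ℝ, ℂ) :=
  SchwartzMap.postcompCLM (𝕜 := ℝ) (Complex.conjCLE : ℂ →L[ℝ] ℂ) ψ

theorem conjSchwartz_apply (ψ : 𝓢(ℝ, ℂ)) (x : ℝ) :
    conjSchwartz ψ x = (starRingEnd ℂ) (ψ x) := rfl

theorem deriv_conjSchwartz (ψ : 𝓢(ℝ, ℂ)) (x : ℝ) :
    deriv (conjSchwartz ψ) x = (starRingEnd ℂ) (deriv ψ x) :=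
  ((Complex.conjCLE : ℂ →L[ℝ] ℂ).hasFDerivAt.comp_hasDerivAt x (ψ.hasDerivAt x)).deriv

theorem inner_position (ψ φ : 𝓢(ℝ, ℂ)) :
    ⟪incl (position ψ), incl φ⟫_ℂ = ⟪incl ψ, incl (position φ)⟫_ℂ := by
  rw [inner_incl, inner_incl]
  refine integral_congr_ae (Eventually.of_forall fun x => ?_)
  simp only [position_apply, map_mul, Complex.conj_ofReal]
  ring

/-- Integration by parts; the resulting sign is absorbed by the conjugate of `-i`. -/
theorem inner_momentum (ψ φ : 𝓢(ℝ, ℂ)) :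
    ⟪incl (momentum ψ), incl φ⟫_ℂ = ⟪incl ψ, incl (momentum φ)⟫_ℂ := by
  rw [inner_incl, inner_incl]
  have h := SchwartzMap.integral_mul_deriv_eq_neg_deriv_mul (conjSchwartz ψ) φ
  simp only [deriv_conjSchwartz, conjSchwartz_apply] at h
  calc ∫ x, (starRingEnd ℂ) (momentum ψ x) * φ x
      = Complex.I * ∫ x, (starRingEnd ℂ) (deriv ψ x) * φ x := by
        rw [← integral_const_mul]
        refine integral_congr_ae (Eventually.of_forall fun x => ?_)
        simp only [momentum_apply, map_mul, map_neg, Complex.conj_I]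
        ring
    _ = -Complex.I * ∫ x, (starRingEnd ℂ) (ψ x) * deriv φ x := by
        rw [h]
        ring
    _ = _ := by
        rw [← integral_const_mul]
        refine integral_congr_ae (Eventually.of_forall fun x => ?_)
        simp only [momentum_apply]
        ring

/-- The shifted oscillator Hamiltonian `(P² + Q² + 1) / 2`. -/
def oscillator : 𝓢(ℝ, ℂ) →L[ℂ] 𝓢(ℝ, ℂ) :=
  (1 / 2 : ℂ) • (momentum * momentum + position * position + 1)

theorem ofReal_sqrt_mul_self (n : ℕ) : (Real.sqrt n : ℂ) * (Real.sqrt n : ℂ) = n := by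
  rw [← Complex.ofReal_mul, Real.mul_self_sqrt (Nat.cast_nonneg n)]
  simp

/-- In `P² + Q²` the `h_{n±2}` components cancel, since those of `P²` carry the extra factor `(±i)²
= -1`. The diagonal parts add up to `(n + 1) + n`. -/
theorem oscillator_hermiteFun (n : ℕ) :
    oscillator (hermiteFun n) = ((n + 1 : ℕ) : ℂ) • hermiteFun n := by
  have h1 := ofReal_sqrt_mul_self (n + 1)
  have h2 := ofReal_sqrt_mul_self n
  have h3 := invSqrtTwo_mul_self
  have h4 := Complex.I_mul_I
  have hn : (Real.sqrt n : ℂ) • hermiteFun (n - 1 + 1) = (Real.sqrt n : ℂ) • hermiteFun n := by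
    cases n <;> simp
  have hn' : (Real.sqrt n : ℂ) * (Real.sqrt ((n - 1 + 1 : ℕ) : ℝ) : ℂ) = n := by
    cases n with
    | zero => simp
    | succ n => exact h2
  have hn'' : (Real.sqrt n : ℂ) • ((Real.sqrt ((n - 1 + 1 : ℕ) : ℝ) : ℂ) • hermiteFun (n - 1 + 1)) =
      (n : ℂ) • hermiteFun n := by
    rw [smul_comm, hn, smul_smul, mul_comm, hn']
  have hP : momentum (momentum (hermiteFun n)) + position (position (hermiteFun n)) =
      (2 * n + 1 : ℂ) • hermiteFun n := by
    simp only [position_hermiteFun, momentum_hermiteFun, map_add, map_smul, smul_add, smul_smul,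
      Nat.add_sub_cancel] at hn'' ⊢
    ext x
    have hx := congrArg (fun ψ : 𝓢(ℝ, ℂ) => ψ x) hn''
    simp only [add_apply, smul_apply, smul_eq_mul] at hx ⊢
    push_cast at hx h1 ⊢
    linear_combination (2 * invSqrtTwo * invSqrtTwo) * hx +
      (2 * invSqrtTwo * invSqrtTwo) * hermiteFun n x * h1 + 2 * (2 * n + 1) * hermiteFun n x * h3 +
      invSqrtTwo ^ 2 * ((Real.sqrt (n + 1) : ℂ) * (Real.sqrt (n + 1 + 1) : ℂ) *
        hermiteFun (n + 1 + 1) x - (Real.sqrt (n + 1) : ℂ) ^ 2 * hermiteFun n x -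
        (Real.sqrt n : ℂ) * (Real.sqrt ((n - 1 : ℕ) + 1) : ℂ) * hermiteFun (n - 1 + 1) x +
        (Real.sqrt n : ℂ) * (Real.sqrt (n - 1 : ℕ) : ℂ) * hermiteFun (n - 1 - 1) x) * h4
  simp only [oscillator, smul_apply, add_apply, mul_apply_eq_comp, one_apply_eq_self, hP]
  rw [← one_smul ℂ (hermiteFun n), smul_smul, ← add_smul, smul_smul, smul_smul]
  congr 1
  push_cast
  ring

theorem inner_oscillator (ψ φ : 𝓢(ℝ, ℂ)) :
    ⟪incl (oscillator ψ), incl φ⟫_ℂ = ⟪incl ψ, incl (oscillator φ)⟫_ℂ := by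
  simp only [oscillator, smul_apply, add_apply, mul_apply_eq_comp, one_apply_eq_self, map_add,
    map_smul, inner_smul_left, inner_smul_right, inner_add_left, inner_add_right, inner_position,
    inner_momentum]
  rw [map_div₀, map_one, Complex.conj_ofNat]

/-- Eigenvectors of a symmetric operator for distinct eigenvalues. -/
theorem inner_hermiteFun_of_ne {m n : ℕ} (h : m ≠ n) :
    ⟪incl (hermiteFun m), incl (hermiteFun n)⟫_ℂ = 0 := by
  have h1 := inner_oscillator (hermiteFun m) (hermiteFun n)
  rw [oscillator_hermiteFun, oscillator_hermiteFun, map_smul, map_smul, inner_smul_left,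
    inner_smul_right, Complex.conj_natCast] at h1
  have h2 : ((m + 1 : ℕ) - (n + 1 : ℕ) : ℂ) * ⟪incl (hermiteFun m), incl (hermiteFun n)⟫_ℂ = 0 := by
    rw [sub_mul, h1, sub_self]
  refine (mul_eq_zero.mp h2).resolve_left (sub_ne_zero.mpr ?_)
  exact_mod_cast fun h' => h (Nat.succ_injective h')

theorem inner_hermiteFun_self (n : ℕ) : ⟪incl (hermiteFun n), incl (hermiteFun n)⟫_ℂ = 1 := by
  induction n with
  | zero =>
    rw [inner_incl]
    have h : ∀ x, (starRingEnd ℂ) (hermiteFun 0 x) * hermiteFun 0 x =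
        (((Real.sqrt Real.pi)⁻¹ * Real.exp (-1 * x ^ 2) : ℝ) : ℂ) := fun x => by
      rw [hermiteFun_eq, Complex.conj_ofReal, ← Complex.ofReal_mul]
      congr 1
      have h1 : Real.exp (-1 * x ^ 2) = Real.exp (-(x ^ 2 / 2)) * Real.exp (-(x ^ 2 / 2)) := by
        rw [← Real.exp_add]
        ring_nf
      have h2 : (Real.sqrt (Real.sqrt Real.pi))⁻¹ * (Real.sqrt (Real.sqrt Real.pi))⁻¹ =
          (Real.sqrt Real.pi)⁻¹ := by
        rw [← mul_inv, Real.mul_self_sqrt (Real.sqrt_nonneg _)]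
      rw [h1, ← h2]
      simp [hermiteReal]
      ring
    simp_rw [h]
    rw [integral_complex_ofReal, integral_const_mul, integral_gaussian, div_one,
      inv_mul_cancel₀ (by positivity), Complex.ofReal_one]
  | succ n ih =>
    -- Symmetry of `Q` between `h_n` and `h_{n+1}` compares their norms: both sides carry the same
    -- coefficient `√((n+1)/2)`, and the other terms vanish by orthogonality.
    have h1 := inner_position (hermiteFun n) (hermiteFun (n + 1))
    have h2 : ⟪incl (hermiteFun (n - 1)), incl (hermiteFun (n + 1))⟫_ℂ = 0 :=
      inner_hermiteFun_of_ne (by omega)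
    have h3 : ⟪incl (hermiteFun n), incl (hermiteFun (n + 1 + 1))⟫_ℂ = 0 :=
      inner_hermiteFun_of_ne (by omega)
    rw [position_hermiteFun, position_hermiteFun] at h1
    simp only [map_add, map_smul, inner_add_left, inner_add_right, inner_smul_left,
      inner_smul_right, h2, h3, Nat.add_sub_cancel, ih, map_mul, conj_invSqrtTwo,
      Complex.conj_ofReal, mul_zero, add_zero, zero_add, mul_one] at h1
    have h4 : invSqrtTwo * (Real.sqrt ((n + 1 : ℕ) : ℝ) : ℂ) ≠ 0 := by
      refine mul_ne_zero (fun h => ?_) ?_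
      · simpa [h] using invSqrtTwo_mul_self
      · rw [Complex.ofReal_ne_zero]
        positivity
    exact mul_left_cancel₀ h4 (by rw [h1, mul_one])

theorem orthonormal_hermiteFun : Orthonormal ℂ fun n => incl (hermiteFun n) := by
  rw [orthonormal_iff_ite]
  intro m n
  split_ifs with h
  · rw [h, inner_hermiteFun_self]
  · exact inner_hermiteFun_of_ne h

end Hermite

/-! ### Completeness of the Hermite functions -/

section Completeness

open scoped FourierTransform ContDiff

/-- An integrable function on the real line whose Fourier transform vanishes is zero. -/
theorem ae_eq_zero_of_fourier_eq_zero {G : ℝ → ℂ} (hG : Integrable G)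
    (h : ∀ t, 𝓕 G t = 0) : G =ᵐ[volume] 0 := by
  refine ae_eq_zero_of_integral_contDiff_smul_eq_zero hG.locallyIntegrable fun g hg hc => ?_
  have hg₁ : HasCompactSupport (Complex.ofRealCLM ∘ g) := hc.comp_left rfl
  have hg₂ : ContDiff ℝ ∞ (Complex.ofRealCLM ∘ g) := by fun_prop
  set ψ : 𝓢(ℝ, ℂ) := hg₁.toSchwartzMap hg₂
  -- The test function is written as a Fourier transform, which is then moved onto `G`.
  set η : 𝓢(ℝ, ℂ) := 𝓕⁻ ψ
  have hψ : 𝓕 η = ψ := FourierTransform.fourier_fourierInv_eq ψ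
  have hflip : ∫ x, 𝓕 η x • G x = ∫ x, η x • 𝓕 G x := by
    simpa using! VectorFourier.integral_fourierIntegral_smul_eq_flip (L := innerₗ ℝ)
      Real.continuous_fourierChar continuous_inner (η.integrable (μ := volume)) hG
  rw [hψ] at hflip
  simp only [h, smul_zero, integral_zero] at hflip
  rw [← hflip]
  rfl

theorem memLp_gaussian_quarter :
    MemLp (fun x : ℝ => Real.exp (-(1 / 4) * x ^ 2)) 2 volume := by
  rw [memLp_two_iff_integrable_sq (by fun_prop)]
  refine (integrable_exp_neg_mul_sq (b := 1 / 2) (by norm_num)).congr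
    (Eventually.of_forall fun x => ?_)
  simp only [← Real.exp_nat_mul]
  congr 1
  push_cast
  ring

/-- By `|t x| ≤ t² + x²/4`, the weight is at most `e^{t²} e^{-x²/4}`, which is square integrable.
This is the domination needed to expand a Fourier kernel under the integral. -/
theorem integrable_exp_mul_gaussian_mul {g : ℝ → ℂ} (hg : MemLp g 2 volume) (t : ℝ) :
    Integrable (fun x => Real.exp (|t * x|) * (Real.exp (-(x ^ 2 / 2)) * ‖g x‖)) := by
  have h1 : Integrable (fun x => Real.exp (-(1 / 4) * x ^ 2) * ‖g x‖) :=
    memLp_gaussian_quarter.integrable_mul hg.norm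
  refine (h1.const_mul (Real.exp (t ^ 2))).mono ?_ (Eventually.of_forall fun x => ?_)
  · have := hg.1.norm
    exact (by fun_prop : AEStronglyMeasurable (fun x : ℝ => Real.exp (|t * x|)) volume).mul
      ((by fun_prop : AEStronglyMeasurable (fun x : ℝ => Real.exp (-(x ^ 2 / 2))) volume).mul this)
  · rw [← mul_assoc, ← mul_assoc, ← Real.exp_add, ← Real.exp_add, norm_mul, norm_mul]
    refine mul_le_mul_of_nonneg_right ?_ (norm_nonneg ‖g x‖)
    rw [Real.norm_of_nonneg (Real.exp_nonneg _),
      Real.norm_of_nonneg (Real.exp_nonneg _), Real.exp_le_exp, abs_mul]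
    nlinarith [sq_nonneg (|t| - |x| / 2), sq_abs t, sq_abs x]

/-- A square integrable function all of whose moments against the Gaussian vanish is zero. -/
theorem ae_eq_zero_of_gaussian_moments {g : ℝ → ℂ} (hg : MemLp g 2 volume)
    (h : ∀ k : ℕ, ∫ x : ℝ, (x : ℂ) ^ k * (Real.exp (-(x ^ 2 / 2)) : ℂ) * g x = 0) :
    g =ᵐ[volume] 0 := by
  set G : ℝ → ℂ := fun x => (Real.exp (-(x ^ 2 / 2)) : ℂ) * g x with hGdef
  have hGm : AEStronglyMeasurable G volume :=
    (by fun_prop : AEStronglyMeasurable (fun x : ℝ => (Real.exp (-(x ^ 2 / 2)) : ℂ)) volume).mul hg.1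
  have hGn : ∀ x, ‖G x‖ = Real.exp (-(x ^ 2 / 2)) * ‖g x‖ := fun x => by
    rw [hGdef, norm_mul, Complex.norm_real, Real.norm_of_nonneg (Real.exp_nonneg _)]
  have hGi : Integrable G := by
    refine (integrable_norm_iff hGm).mp ?_
    simpa [hGn] using integrable_exp_mul_gaussian_mul hg 0
  have hF : ∀ t, 𝓕 G t = 0 := fun t => by
    set s : ℝ := -(2 * Real.pi * t) with hs
    have hsum : ∀ x : ℝ, HasSum (fun n : ℕ => ((s * x : ℝ) * Complex.I) ^ n / n.factorial * G x)
        (Complex.exp ((s * x : ℝ) * Complex.I) * G x) := fun x => by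
      refine HasSum.mul_right (G x) ?_
      rw [Complex.exp_eq_exp_ℂ]
      exact NormedSpace.expSeries_div_hasSum_exp _
    have hbsum : ∀ x : ℝ, HasSum (fun n : ℕ => |s * x| ^ n / n.factorial * ‖G x‖)
        (Real.exp |s * x| * ‖G x‖) := fun x => by
      refine HasSum.mul_right _ ?_
      rw [Real.exp_eq_exp_ℝ]
      exact NormedSpace.expSeries_div_hasSum_exp _
    -- The Fourier kernel `e^{isx}` is expanded in powers of `x` and integrated term by term,
    -- dominated by `e^{|sx|} |G|`. Every term is a multiple of a vanishing moment, so the transform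
    -- vanishes.
    have key := hasSum_integral_of_dominated_convergence (μ := volume)
      (fun (n : ℕ) x => |s * x| ^ n / n.factorial * ‖G x‖)
      (F := fun (n : ℕ) x => ((s * x : ℝ) * Complex.I) ^ n / n.factorial * G x)
      (f := fun x => Complex.exp ((s * x : ℝ) * Complex.I) * G x)
      (fun n => (by fun_prop : AEStronglyMeasurable
        (fun x : ℝ => ((s * x : ℝ) * Complex.I) ^ n / n.factorial) volume).mul hGm)
      (fun n => Eventually.of_forall fun x => by
        rw [norm_mul, norm_div, norm_pow, norm_mul, Complex.norm_I, Complex.norm_real,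
          Complex.norm_natCast, mul_one, Real.norm_eq_abs])
      (Eventually.of_forall fun x => (hbsum x).summable)
      (by
        simp_rw [fun x => (hbsum x).tsum_eq, hGn]
        exact integrable_exp_mul_gaussian_mul hg s)
      (Eventually.of_forall hsum)
    have hz : ∀ n : ℕ, ∫ x, ((s * x : ℝ) * Complex.I) ^ n / n.factorial * G x = 0 := fun n => by
      have : ∀ x : ℝ, ((s * x : ℝ) * Complex.I) ^ n / n.factorial * G x =
          ((s * Complex.I) ^ n / n.factorial) *
            ((x : ℂ) ^ n * (Real.exp (-(x ^ 2 / 2)) : ℂ) * g x) := fun x => by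
        rw [hGdef]
        push_cast
        ring
      simp_rw [this]
      rw [integral_const_mul, h n, mul_zero]
    simp_rw [hz] at key
    have h0 := key.unique hasSum_zero
    rw [Real.fourier_eq]
    rw [← h0]
    refine integral_congr_ae (Eventually.of_forall fun x => ?_)
    simp only [Circle.smul_def, Real.fourierChar_apply, smul_eq_mul]
    congr 2
    rw [hs]
    simp
    ring
  filter_upwards [ae_eq_zero_of_fourier_eq_zero hGi hF] with x hx
  have h1 : (Real.exp (-(x ^ 2 / 2)) : ℂ) ≠ 0 := Complex.ofReal_ne_zero.mpr (Real.exp_ne_zero _)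
  exact (mul_eq_zero.mp hx).resolve_left h1

/-- The Gaussian is a multiple of `h_0`, and the recurrence keeps the span stable under `Q`. -/
theorem position_pow_gaussian_mem_span (k : ℕ) :
    (position ^ k) gaussian ∈ Submodule.span ℂ (Set.range hermiteFun) := by
  induction k with
  | zero =>
    have h : (gaussian : 𝓢(ℝ, ℂ)) =
        ((Real.sqrt (Real.sqrt Real.pi) : ℝ) : ℂ) • hermiteFun 0 := by
      ext x
      have h' : Real.sqrt (Real.sqrt Real.pi) ≠ 0 := by positivity
      rw [smul_apply, hermiteFun_apply, gaussian_apply, smul_eq_mul, ← Complex.ofReal_mul]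
      congr 1
      simp [h']
    rw [pow_zero, one_apply_eq_self, h]
    exact Submodule.smul_mem _ _ (Submodule.subset_span ⟨0, rfl⟩)
  | succ k ih =>
    rw [pow_succ', mul_apply_eq_comp]
    generalize (position ^ k) gaussian = χ at ih
    induction ih using Submodule.span_induction with
    | mem ψ hψ =>
      obtain ⟨n, rfl⟩ := hψ
      rw [position_hermiteFun]
      exact Submodule.add_mem _ (Submodule.smul_mem _ _ (Submodule.subset_span ⟨_, rfl⟩))
        (Submodule.smul_mem _ _ (Submodule.subset_span ⟨_, rfl⟩))
    | zero => simp
    | add ψ φ _ _ hψ hφ =>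
      rw [map_add]
      exact Submodule.add_mem _ hψ hφ
    | smul c ψ _ hψ =>
      rw [map_smul]
      exact Submodule.smul_mem _ _ hψ

theorem position_pow_apply (k : ℕ) (ψ : 𝓢(ℝ, ℂ)) (x : ℝ) :
    (position ^ k) ψ x = (x : ℂ) ^ k * ψ x := by
  induction k with
  | zero => simp
  | succ k ih => rw [pow_succ', mul_apply_eq_comp, position_apply, ih, pow_succ', mul_assoc]

/-- Orthogonality to all Hermite functions makes all moments against the Gaussian vanish. -/
theorem eq_zero_of_inner_hermiteFun (g : L2R) (h : ∀ n, ⟪incl (hermiteFun n), g⟫_ℂ = 0) :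
    g = 0 := by
  have hspan : ∀ ψ ∈ Submodule.span ℂ (Set.range hermiteFun), ⟪incl ψ, g⟫_ℂ = 0 := fun ψ hψ => by
    induction hψ using Submodule.span_induction with
    | mem ψ hψ =>
      obtain ⟨n, rfl⟩ := hψ
      exact h n
    | zero => rw [map_zero, inner_zero_left]
    | add ψ φ _ _ hψ hφ => rw [map_add, inner_add_left, hψ, hφ, add_zero]
    | smul c ψ _ hψ => rw [map_smul, inner_smul_left, hψ, mul_zero]
  rw [Lp.eq_zero_iff_ae_eq_zero]
  refine ae_eq_zero_of_gaussian_moments (Lp.memLp g) fun k => ?_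
  rw [← hspan _ (position_pow_gaussian_mem_span k), L2.inner_def]
  refine integral_congr_ae ?_
  filter_upwards [SchwartzMap.coeFn_toLp ((position ^ k) gaussian) 2 volume] with x hx
  change _ = ⟪((position ^ k) gaussian).toLp 2 volume x, g x⟫_ℂ
  rw [hx, position_pow_apply, gaussian_apply]
  simp only [RCLike.inner_apply, map_mul, map_pow, Complex.conj_ofReal]
  ring

/-- The Hilbert basis of Hermite functions. -/
def hermiteBasis : HilbertBasis ℕ ℂ L2R :=
  HilbertBasis.mkOfOrthogonalEqBot orthonormal_hermiteFun <| by
    rw [Submodule.eq_bot_iff]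
    intro g hg
    refine eq_zero_of_inner_hermiteFun g fun n => ?_
    exact (Submodule.mem_orthogonal _ _).mp hg _ (Submodule.subset_span ⟨n, rfl⟩)

theorem hermiteBasis_apply (n : ℕ) : hermiteBasis n = incl (hermiteFun n) := by
  rw [hermiteBasis, HilbertBasis.coe_mkOfOrthogonalEqBot]

theorem hasSum_hermite (x : L2R) :
    HasSum (fun n => ⟪incl (hermiteFun n), x⟫_ℂ • incl (hermiteFun n)) x := by
  simpa only [HilbertBasis.repr_apply_apply, hermiteBasis_apply] using hermiteBasis.hasSum_repr x

end Completeness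

/-! ### The fluctuation operators in the number basis -/

section SpinChain

variable {M : ℕ}

/-- The number of excited spins in a configuration. -/
def weight (s : Fin M → Fin 2) : ℕ := (Finset.univ.filter fun j => s j = 1).card

theorem weight_le (s : Fin M → Fin 2) : weight s ≤ M :=
  (Finset.card_le_univ _).trans_eq (Fintype.card_fin M)

theorem weight_comp (s : Fin M → Fin 2) (σ : Equiv.Perm (Fin M)) : weight (s ∘ σ) = weight s :=
  Finset.card_equiv σ (by simp)

theorem card_filter_eq_zero (s : Fin M → Fin 2) :
    (Finset.univ.filter fun j => s j = 0).card = M - weight s := by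
  have h := Finset.card_filter_add_card_filter_not (s := Finset.univ) fun j => s j = 1
  have h' : (Finset.univ.filter fun j => ¬ s j = 1) = Finset.univ.filter fun j => s j = 0 :=
    Finset.filter_congr fun j _ => by omega
  rw [h', Finset.card_univ, Fintype.card_fin] at h
  rw [weight]
  omega

/-- Equal weights give the fibres over `0` and over `1` equal cardinalities; bijections of the
fibres glue to a permutation. -/
theorem exists_perm_of_weight_eq {s t : Fin M → Fin 2} (h : weight s = weight t) :
    ∃ σ : Equiv.Perm (Fin M), t ∘ σ = s := by
  have hc : ∀ c : Fin 2, Nonempty ({j // s j = c} ≃ {j // t j = c}) := fun c => by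
    refine ⟨Fintype.equivOfCardEq ?_⟩
    rw [Fintype.card_subtype, Fintype.card_subtype]
    fin_cases c
    · change (Finset.univ.filter fun j => s j = 0).card = (Finset.univ.filter fun j => t j = 0).card
      rw [card_filter_eq_zero, card_filter_eq_zero, h]
    · exact h
  exact ⟨Equiv.ofFiberEquiv fun c => (hc c).some, funext fun j => Equiv.ofFiberEquiv_map _ j⟩

theorem card_weight_eq (M n : ℕ) :
    (Finset.univ.filter fun s : Fin M → Fin 2 => weight s = n).card = M.choose n := by
  have h : (Finset.powersetCard n (Finset.univ : Finset (Fin M))).card = M.choose n := by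
    rw [Finset.card_powersetCard, Finset.card_univ, Fintype.card_fin]
  rw [← h]
  refine Finset.card_nbij' (fun s => Finset.univ.filter fun j => s j = 1)
    (fun A j => if j ∈ A then 1 else 0) ?_ ?_ ?_ ?_
  · intro s hs
    exact Finset.mem_coe.mpr (Finset.mem_powersetCard.mpr ⟨Finset.subset_univ _,
      (Finset.mem_filter.mp (Finset.mem_coe.mp hs)).2⟩)
  · intro A hA
    refine Finset.mem_coe.mpr (Finset.mem_filter.mpr ⟨Finset.mem_univ _, ?_⟩)
    rw [weight]
    simpa using (Finset.mem_powersetCard.mp (Finset.mem_coe.mp hA)).2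
  · intro s _
    funext j
    by_cases h : s j = 1
    · simp [h]
    · have : s j = 0 := by omega
      simp [this]
  · intro A _
    ext j
    simp

theorem weight_update_one {s : Fin M → Fin 2} {j : Fin M} (h : s j = 0) :
    weight (Function.update s j 1) = weight s + 1 := by
  have : (Finset.univ.filter fun k => Function.update s j 1 k = 1) =
      insert j (Finset.univ.filter fun k => s k = 1) := by
    ext k
    by_cases hk : k = j
    · simp [hk]
    · simp [hk]
  rw [weight, this, Finset.card_insert_of_notMem (by simp [h]), weight]

theorem weight_update_zero {s : Fin M → Fin 2} {j : Fin M} (h : s j = 1) :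
    weight (Function.update s j 0) = weight s - 1 := by
  have := weight_update_one (s := Function.update s j 0) (j := j) (by simp)
  rw [Function.update_idem, ← h, Function.update_eq_self] at this
  omega

/-- The component of the number vector `|n; M⟩` at a configuration of weight `w`: it is
`(M choose n)^{-1/2}` for `w = n`, and zero otherwise. -/
def numberCoeff (M n w : ℕ) : ℂ := if w = n then (((Real.sqrt (M.choose n))⁻¹ : ℝ) : ℂ) else 0

theorem pureTensor_basis_apply {n : ℕ} (s : Fin M → Fin 2) :
    pureTensor (fun j : Fin M => if (j : ℕ) < M - n then Pi.single 0 1 else Pi.single 1 1) s =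
      if s = (fun j : Fin M => if (j : ℕ) < M - n then 0 else 1) then 1 else 0 := by
  change ∏ j : Fin M, (if (j : ℕ) < M - n then (Pi.single 0 1 : Fin 2 → ℂ) else Pi.single 1 1) (s j) = _
  have h : ∀ j : Fin M,
      (if (j : ℕ) < M - n then (Pi.single 0 1 : Fin 2 → ℂ) else Pi.single 1 1) (s j) =
        if s j = (if (j : ℕ) < M - n then 0 else 1) then 1 else 0 := fun j => by
    split_ifs <;> simp_all
  simp_rw [h, Finset.prod_ite_zero, funext_iff]
  simp

theorem weight_basis {n : ℕ} (hn : n ≤ M) :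
    weight (fun j : Fin M => if (j : ℕ) < M - n then (0 : Fin 2) else 1) = n := by
  have h : (Finset.univ.filter fun j : Fin M =>
      (if (j : ℕ) < M - n then (0 : Fin 2) else 1) = 0).card = M - n := by
    have : (Finset.univ.filter fun j : Fin M =>
      (if (j : ℕ) < M - n then (0 : Fin 2) else 1) = 0) =
        Finset.univ.filter fun j : Fin M => (j : ℕ) < M - n := by
      refine Finset.filter_congr fun j _ => ?_
      split_ifs with h <;> simp [h]
    rw [this, Fin.card_filter_val_lt]
    omega
  have h2 := card_filter_eq_zero (fun j : Fin M => if (j : ℕ) < M - n then (0 : Fin 2) else 1)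
  have h3 := weight_le (fun j : Fin M => if (j : ℕ) < M - n then (0 : Fin 2) else 1)
  omega

theorem symmetrizer_apply (x : Spins M) (s : Fin M → Fin 2) :
    symmetrizer M x s = (M.factorial : ℂ)⁻¹ * ∑ π : Equiv.Perm (Fin M), x (s ∘ π) := by
  have h : ∀ π : Equiv.Perm (Fin M), permute π x s = x (s ∘ π) := fun _ => rfl
  simp [symmetrizer, h]

theorem symmetrizer_apply_comp (x : Spins M) (s : Fin M → Fin 2) (σ : Equiv.Perm (Fin M)) :
    symmetrizer M x (s ∘ σ) = symmetrizer M x s := by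
  rw [symmetrizer_apply, symmetrizer_apply]
  congr 1
  exact Fintype.sum_equiv (Equiv.mulLeft σ) _ _ fun π => rfl

/-- Permuting factors only reorders the coordinates. This fixes the normalization of `|n; M⟩`
without counting stabilizers. -/
theorem sum_symmetrizer (x : Spins M) : ∑ s, symmetrizer M x s = ∑ s, x s := by
  simp_rw [symmetrizer_apply]
  rw [← Finset.mul_sum, Finset.sum_comm]
  have h : ∀ π : Equiv.Perm (Fin M), ∑ s : Fin M → Fin 2, x (s ∘ π) = ∑ s, x s := fun π =>
    Fintype.sum_equiv (Equiv.arrowCongr π.symm (Equiv.refl _)) _ _ fun s => rfl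
  simp_rw [h]
  rw [Finset.sum_const, Finset.card_univ, Fintype.card_perm, Fintype.card_fin, nsmul_eq_mul,
    inv_mul_cancel_left₀ (by exact_mod_cast M.factorial_ne_zero)]

/-- The symmetrized product vector is supported on weight `n` and constant there. Its coordinates
sum to `1`, so the constant is `1 / (M choose n)`, and the prefactor turns it into an inverse square
root. -/
theorem numberVec_apply {n : ℕ} (hn : n ≤ M) (s : Fin M → Fin 2) :
    numberVec M n s = numberCoeff M n (weight s) := by
  set b : Fin M → Fin 2 := fun j : Fin M => if (j : ℕ) < M - n then 0 else 1 with hb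
  set x : Spins M :=
    pureTensor fun j : Fin M => if (j : ℕ) < M - n then Pi.single 0 1 else Pi.single 1 1
  have hx : ∀ s, x s = if s = b then 1 else 0 := pureTensor_basis_apply
  have hwb : weight b = n := weight_basis hn
  have h0 : ∀ s, weight s ≠ n → symmetrizer M x s = 0 := fun s hs => by
    rw [symmetrizer_apply, Finset.sum_eq_zero, mul_zero]
    intro π _
    rw [hx, if_neg]
    intro h
    exact hs (by rw [← weight_comp s π, h, hwb])
  have h1 : ∀ s, weight s = n → symmetrizer M x s = symmetrizer M x b := fun s hs => by
    obtain ⟨σ, rfl⟩ := exists_perm_of_weight_eq (hs.trans hwb.symm)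
    exact symmetrizer_apply_comp x b σ
  have h2 : (M.choose n : ℂ) * symmetrizer M x b = 1 := by
    have h3 : ∑ s, symmetrizer M x s = 1 := by
      rw [sum_symmetrizer]
      simp_rw [hx]
      simp
    rw [← h3, ← Finset.sum_filter_of_ne (p := fun s => weight s = n)
      fun s _ hs => by_contra fun h => hs (h0 s h), Finset.sum_congr rfl
      fun s hs => h1 s (Finset.mem_filter.mp hs).2, Finset.sum_const, card_weight_eq, nsmul_eq_mul]
  change ((Real.sqrt (M.choose n) : ℝ) : ℂ) * symmetrizer M x s = _
  rw [numberCoeff]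
  split_ifs with h
  · have hc : 0 < (M.choose n : ℝ) := by exact_mod_cast Nat.choose_pos hn
    have h4 : ((Real.sqrt (M.choose n) : ℝ) : ℂ) * ((Real.sqrt (M.choose n) : ℝ) : ℂ) =
      M.choose n := ofReal_sqrt_mul_self _
    have h5 : ((Real.sqrt (M.choose n) : ℝ) : ℂ) ≠ 0 := by
      rw [Complex.ofReal_ne_zero]
      positivity
    rw [h1 s h, Complex.ofReal_inv]
    refine eq_inv_of_mul_eq_one_right ?_
    rw [← mul_assoc, h4, h2]
  · rw [h0 s h, mul_zero]

theorem numberVec_mem {n : ℕ} (hn : n ≤ M) : numberVec M n ∈ symSpins M := fun π => by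
  ext s
  change numberVec M n (s ∘ π) = numberVec M n s
  rw [numberVec_apply hn, numberVec_apply hn, weight_comp]

theorem inner_numberVec {m n : ℕ} (hm : m ≤ M) (hn : n ≤ M) :
    ⟪numberVec M m, numberVec M n⟫_ℂ = if m = n then 1 else 0 := by
  rw [PiLp.inner_apply]
  simp_rw [numberVec_apply hm, numberVec_apply hn]
  split_ifs with h
  · subst h
    rw [← Finset.sum_filter_of_ne (p := fun s => weight s = m)
      fun s _ hs => by_contra fun h => hs (by simp [numberCoeff, h]), Finset.sum_congr rfl
      fun s hs => by rw [(Finset.mem_filter.mp hs).2], Finset.sum_const, card_weight_eq,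
      nsmul_eq_mul, numberCoeff, if_pos rfl]
    have hc : (0 : ℝ) < M.choose m := by exact_mod_cast Nat.choose_pos hm
    have h5 : (Real.sqrt (M.choose m))⁻¹ * (Real.sqrt (M.choose m))⁻¹ = (M.choose m : ℝ)⁻¹ := by
      rw [← mul_inv, Real.mul_self_sqrt hc.le]
    rw [RCLike.inner_apply, Complex.conj_ofReal, ← Complex.ofReal_mul, h5]
    push_cast
    exact mul_inv_cancel₀ (by exact_mod_cast hc.ne')
  · refine Finset.sum_eq_zero fun s _ => ?_
    rw [numberCoeff, numberCoeff]
    split_ifs with h1 h2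
    · exact absurd (h1.symm.trans h2) h
    all_goals simp

/-- The matrix element `√n √((M + 1 - n) / M)` of the fluctuation operators. -/
def spinCoeff (M n : ℕ) : ℝ := Real.sqrt n * Real.sqrt ((M + 1 - n : ℕ) / M)

theorem spinCoeff_nonneg (M n : ℕ) : 0 ≤ spinCoeff M n := by unfold spinCoeff; positivity

theorem spinCoeff_zero (M : ℕ) : spinCoeff M 0 = 0 := by simp [spinCoeff]

/-- Truncated subtraction builds the cutoff into the formula: in particular the raising coefficient
out of `n = M` is zero. -/
theorem spinCoeff_of_lt {n : ℕ} (h : M < n) : spinCoeff M n = 0 := by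
  simp [spinCoeff, Nat.sub_eq_zero_of_le (show M + 1 ≤ n from h)]

theorem spinCoeff_le (M n : ℕ) : spinCoeff M n ≤ Real.sqrt n := by
  -- At `n = 0` the ratio `(M + 1) / M` exceeds `1` for positive `M`, but the factor `√n` vanishes.
  rcases Nat.eq_zero_or_pos n with rfl | hn
  · simp [spinCoeff]
  · refine mul_le_of_le_one_right (Real.sqrt_nonneg _) (Real.sqrt_le_one.mpr ?_)
    refine div_le_one_of_le₀ ?_ (Nat.cast_nonneg M)
    exact_mod_cast (by omega : M + 1 - n ≤ M)

theorem tendsto_spinCoeff (n : ℕ) :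
    Tendsto (fun M => spinCoeff M n) atTop (𝓝 (Real.sqrt n)) := by
  have h : Tendsto (fun M : ℕ => ((M + 1 - n : ℕ) : ℝ) / M) atTop (𝓝 1) := by
    have h1 : Tendsto (fun M : ℕ => 1 + (1 - n : ℝ) / M) atTop (𝓝 1) := by
      simpa using (tendsto_const_div_atTop_nhds_zero_nat (1 - n : ℝ)).const_add 1
    refine h1.congr' ?_
    filter_upwards [eventually_ge_atTop n, eventually_gt_atTop 0] with M hM hM0
    have : (M : ℝ) ≠ 0 := by positivity
    rw [Nat.cast_sub (by omega)]
    field_simp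
    push_cast
    ring
  have h2 := (h.sqrt).const_mul (Real.sqrt n)
  rwa [Real.sqrt_one, mul_one] at h2

/-- Flipping one spin changes the weight by one. The `M - weight s` spins in state `0` see `p`, the
`weight s` excited ones see `q`. -/
theorem siteOp_offDiag_sum (p q : ℂ) (ξ : ℕ → ℂ) (x : Spins M)
    (hx : ∀ s, x s = ξ (weight s)) (s : Fin M → Fin 2) :
    ∑ j : Fin M, siteOp j !![0, p; q, 0] x s =
      (M - weight s : ℕ) * (p * ξ (weight s + 1)) + weight s * (q * ξ (weight s - 1)) := by
  have h : ∀ j : Fin M, siteOp j !![0, p; q, 0] x s =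
      (if s j = 0 then p * ξ (weight s + 1) else 0) +
        if s j = 1 then q * ξ (weight s - 1) else 0 := fun j => by
    change ∑ c : Fin 2, (!![0, p; q, 0] : Matrix (Fin 2) (Fin 2) ℂ) (s j) c *
      x (Function.update s j c) = _
    rw [Fin.sum_univ_two]
    obtain h | h : s j = 0 ∨ s j = 1 := by omega
    · rw [hx, hx, weight_update_one h]
      simp [h]
    · rw [hx, hx, weight_update_zero h]
      simp [h]
  simp_rw [h]
  rw [Finset.sum_add_distrib, ← Finset.sum_filter, ← Finset.sum_filter, Finset.sum_const,
    Finset.sum_const, card_filter_eq_zero, nsmul_eq_mul, nsmul_eq_mul]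
  rfl

/-- Both identities come from the square root of `(M choose n+1) (n+1) = (M choose n) (M-n)`. -/
theorem sqrt_choose_ratio {M n : ℕ} (h : n < M) :
    ((n + 1 : ℕ) : ℝ) * (Real.sqrt (M.choose n))⁻¹ =
        Real.sqrt (n + 1 : ℕ) * Real.sqrt (M - n : ℕ) * (Real.sqrt (M.choose (n + 1)))⁻¹ ∧
      ((M - n : ℕ) : ℝ) * (Real.sqrt (M.choose (n + 1)))⁻¹ =
        Real.sqrt (n + 1 : ℕ) * Real.sqrt (M - n : ℕ) * (Real.sqrt (M.choose n))⁻¹ := by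
  have hc1 : 0 < (M.choose n : ℝ) := by exact_mod_cast Nat.choose_pos h.le
  have hc2 : 0 < (M.choose (n + 1) : ℝ) := by exact_mod_cast Nat.choose_pos h
  have hq : Real.sqrt (M.choose (n + 1)) * Real.sqrt (n + 1 : ℕ) =
      Real.sqrt (M.choose n) * Real.sqrt (M - n : ℕ) := by
    rw [← Real.sqrt_mul hc2.le, ← Real.sqrt_mul hc1.le]
    congr 1
    exact_mod_cast Nat.choose_succ_right_eq M n
  have h1 : Real.sqrt (n + 1 : ℕ) * Real.sqrt (n + 1 : ℕ) = (n + 1 : ℕ) :=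
    Real.mul_self_sqrt (Nat.cast_nonneg _)
  have h2 : Real.sqrt (M - n : ℕ) * Real.sqrt (M - n : ℕ) = (M - n : ℕ) :=
    Real.mul_self_sqrt (Nat.cast_nonneg _)
  have hs1 : Real.sqrt (M.choose n) ≠ 0 := by positivity
  have hs2 : Real.sqrt (M.choose (n + 1)) ≠ 0 := by positivity
  constructor
  · rw [← div_eq_mul_inv, ← div_eq_mul_inv, div_eq_div_iff hs1 hs2]
    linear_combination Real.sqrt (n + 1 : ℕ) * hq - Real.sqrt (M.choose (n + 1)) * h1
  · rw [← div_eq_mul_inv, ← div_eq_mul_inv, div_eq_div_iff hs2 hs1]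
    linear_combination -Real.sqrt (M - n : ℕ) * hq - Real.sqrt (M.choose n) * h2

theorem spinCoeff_eq (M n : ℕ) :
    spinCoeff M n = (Real.sqrt M)⁻¹ * (Real.sqrt n * Real.sqrt (M + 1 - n : ℕ)) := by
  rw [spinCoeff, Real.sqrt_div (Nat.cast_nonneg _)]
  ring

/-- An off-diagonal matrix has `Tr(a ϑ) = 0`, so only the site operators contribute; binomial ratios
then give the coefficients. The `if` avoids `numberVec M (M + 1)`, which `numberVec_apply` does not
cover; its coefficient is zero anyway. -/
theorem fluctFull_numberVec {n : ℕ} (hn : n ≤ M) (p q : ℂ) :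
    fluctFull M !![0, p; q, 0] (numberVec M n) =
      (q * spinCoeff M (n + 1)) • (if n < M then numberVec M (n + 1) else 0) +
        (p * spinCoeff M n) • numberVec M (n - 1) := by
  have htr : ((!![0, p; q, 0] : Matrix (Fin 2) (Fin 2) ℂ) * Matrix.single 0 0 1).trace = 0 := by
    rw [Matrix.trace_mul_single]
    simp
  ext s
  have hs := weight_le s
  have h := siteOp_offDiag_sum p q (numberCoeff M n) (numberVec M n) (numberVec_apply hn) s
  have hL : fluctFull M !![0, p; q, 0] (numberVec M n) s =
      (((Real.sqrt M)⁻¹ : ℝ) : ℂ) * ∑ j : Fin M, siteOp j !![0, p; q, 0] (numberVec M n) s := by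
    simp only [fluctFull, htr, zero_smul, sub_zero, LinearMap.smul_apply, LinearMap.sum_apply,
      PiLp.smul_apply, WithLp.ofLp_sum, Finset.sum_apply, smul_eq_mul]
  rw [hL, h, PiLp.add_apply, PiLp.smul_apply, PiLp.smul_apply,
    numberVec_apply ((Nat.sub_le n 1).trans hn), smul_eq_mul, smul_eq_mul, mul_add, add_comm]
  congr 1
  · by_cases hlt : n < M
    · rw [if_pos hlt, numberVec_apply (Nat.succ_le_of_lt hlt), numberCoeff, numberCoeff]
      by_cases hw : weight s = n + 1
      · have h1 := congrArg (Complex.ofReal) (sqrt_choose_ratio hlt).1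
        rw [hw, if_pos (Nat.add_sub_cancel n 1), if_pos rfl, spinCoeff_eq,
          Nat.add_sub_add_right]
        push_cast at h1 ⊢
        linear_combination ((Real.sqrt M : ℂ))⁻¹ * q * h1
      · rw [if_neg hw, mul_zero]
        -- At weight `0`, the truncated `weight s - 1` may equal `n`; the prefactor `weight s`
        -- removes that term.
        rcases Nat.eq_zero_or_pos (weight s) with h0 | h0
        · simp [h0]
        · rw [if_neg (by omega)]
          simp
    · have : n = M := by omega
      subst this
      rw [if_neg hlt, numberCoeff]
      rcases Nat.eq_zero_or_pos (weight s) with h0 | h0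
      · simp [h0]
      · rw [if_neg (by omega)]
        simp
  · cases n with
    | zero => simp [numberCoeff, spinCoeff_zero]
    | succ n =>
      rw [numberCoeff, numberCoeff, Nat.add_sub_cancel]
      by_cases hw : weight s = n
      · have h1 := congrArg (Complex.ofReal) (sqrt_choose_ratio hn).2
        rw [hw, if_pos rfl, if_pos rfl, spinCoeff_eq, Nat.add_sub_add_right]
        push_cast at h1 ⊢
        linear_combination ((Real.sqrt M : ℂ))⁻¹ * p * h1
      · rw [if_neg hw, if_neg (by omega)]
        simp

/-! ### Transport of the fluctuation operators to `L²(ℝ)` -/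

theorem embed_apply (x : symSpins M) : embed M x =
    ∑ k ∈ Finset.range (M + 1), ⟪numberVec M k, (x : Spins M)⟫_ℂ • incl (hermiteFun k) := by
  simp [embed]

theorem sum_inner_numberVec {n : ℕ} (hn : n ≤ M) :
    ∑ k ∈ Finset.range (M + 1), ⟪numberVec M k, numberVec M n⟫_ℂ • incl (hermiteFun k) =
      incl (hermiteFun n) := by
  rw [Finset.sum_eq_single n]
  · rw [inner_numberVec hn hn, if_pos rfl, one_smul]
  · intro k hk hkn
    rw [inner_numberVec (Nat.lt_succ_iff.mp (Finset.mem_range.mp hk)) hn, if_neg hkn, zero_smul]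
  · intro h
    exact absurd (Finset.mem_range.mpr (Nat.lt_succ_of_le hn)) h

theorem inner_hermiteFun_embed (n : ℕ) (x : symSpins M) :
    ⟪incl (hermiteFun n), embed M x⟫_ℂ =
      if n ≤ M then ⟪numberVec M n, (x : Spins M)⟫_ℂ else 0 := by
  rw [embed_apply, inner_sum]
  simp_rw [inner_smul_right, orthonormal_iff_ite.mp orthonormal_hermiteFun]
  simp

theorem adjoint_embed_hermiteFun {n : ℕ} (hn : n ≤ M) :
    ContinuousLinearMap.adjoint (𝕜 := ℂ) (E := symSpins M) (F := L2R) (embed M)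
      (incl (hermiteFun n)) = ⟨numberVec M n, numberVec_mem hn⟩ := by
  refine ext_inner_right ℂ fun x => ?_
  rw [ContinuousLinearMap.adjoint_inner_left, inner_hermiteFun_embed, if_pos hn]
  rfl

theorem adjoint_embed_hermiteFun_of_lt {n : ℕ} (hn : M < n) :
    ContinuousLinearMap.adjoint (𝕜 := ℂ) (E := symSpins M) (F := L2R) (embed M)
      (incl (hermiteFun n)) = 0 := by
  refine ext_inner_right ℂ fun x => ?_
  rw [ContinuousLinearMap.adjoint_inner_left, inner_hermiteFun_embed, if_neg (by omega),
    inner_zero_left]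

/-- No restriction `n ≤ M` is needed: beyond it the adjoint of the embedding kills `h_n`, and both
coefficients vanish. The finite rank operators are thus ladder operators on all Hermite functions,
without an explicit projection. -/
theorem embedOp_fluct_hermiteFun (M n : ℕ) (p q : ℂ) :
    embedOp M (fluct M !![0, p; q, 0]) (incl (hermiteFun n)) =
      (q * spinCoeff M (n + 1)) • incl (hermiteFun (n + 1)) +
        (p * spinCoeff M n) • incl (hermiteFun (n - 1)) := by
  rw [embedOp, ContinuousLinearMap.comp_apply, ContinuousLinearMap.comp_apply]
  rcases lt_or_ge M n with h | h
  · rw [adjoint_embed_hermiteFun_of_lt h, map_zero, map_zero, spinCoeff_of_lt h,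
      spinCoeff_of_lt (h.trans (Nat.lt_succ_self n))]
    simp
  · rw [adjoint_embed_hermiteFun h, embed_apply]
    have hx : ((LinearMap.toContinuousLinearMap (fluct M !![0, p; q, 0])
        ⟨numberVec M n, numberVec_mem h⟩ : symSpins M) : Spins M) =
        fluctFull M !![0, p; q, 0] (numberVec M n) := rfl
    simp only [hx, fluctFull_numberVec h, inner_add_right, inner_smul_right, add_smul, mul_smul]
    rw [Finset.sum_add_distrib, ← Finset.smul_sum, ← Finset.smul_sum,
      ← Finset.smul_sum, ← Finset.smul_sum, sum_inner_numberVec ((Nat.sub_le n 1).trans h)]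
    congr 1
    by_cases hlt : n < M
    · rw [if_pos hlt, sum_inner_numberVec (Nat.succ_le_of_lt hlt)]
    · rw [spinCoeff_of_lt (by omega : M < n + 1)]
      simp

theorem fluctQ_hermiteFun (M n : ℕ) : fluctQ M (incl (hermiteFun n)) =
    (invSqrtTwo * spinCoeff M (n + 1)) • incl (hermiteFun (n + 1)) +
      (invSqrtTwo * spinCoeff M n) • incl (hermiteFun (n - 1)) := by
  rw [← embedOp_fluct_hermiteFun, fluctQ]
  congr 3
  ext i j
  fin_cases i <;> fin_cases j <;> simp [pauli1, invSqrtTwo]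

theorem fluctP_hermiteFun (M n : ℕ) : fluctP M (incl (hermiteFun n)) =
    (Complex.I * invSqrtTwo * spinCoeff M (n + 1)) • incl (hermiteFun (n + 1)) +
      (-Complex.I * invSqrtTwo * spinCoeff M n) • incl (hermiteFun (n - 1)) := by
  rw [← embedOp_fluct_hermiteFun, fluctP]
  congr 3
  ext i j
  fin_cases i <;> fin_cases j <;> simp [pauli2, invSqrtTwo, mul_comm]

end SpinChain

/-! ### Ladder operators on finitely supported sequences -/

section Ladder

/-- The weighted `ℓ¹` norms `∑ k, (k + 1)^s |x k|` on finitely supported sequences. -/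
def weightedNorm (s : ℕ) (x : ℕ →₀ ℂ) : ℝ := x.sum fun k z => ((k : ℝ) + 1) ^ s * ‖z‖

theorem weightedNorm_eq_sum {s : ℕ} {x : ℕ →₀ ℂ} {S : Finset ℕ} (h : x.support ⊆ S) :
    weightedNorm s x = ∑ k ∈ S, ((k : ℝ) + 1) ^ s * ‖x k‖ :=
  Finsupp.sum_of_support_subset x h _ fun k _ => by simp

theorem weightedNorm_nonneg (s : ℕ) (x : ℕ →₀ ℂ) : 0 ≤ weightedNorm s x :=
  Finset.sum_nonneg fun k _ => by positivity

theorem weightedNorm_zero (s : ℕ) : weightedNorm s 0 = 0 := Finsupp.sum_zero_index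

theorem weightedNorm_single (s n : ℕ) (z : ℂ) :
    weightedNorm s (Finsupp.single n z) = ((n : ℝ) + 1) ^ s * ‖z‖ :=
  Finsupp.sum_single_index (by simp)

theorem weightedNorm_add_le (s : ℕ) (x y : ℕ →₀ ℂ) :
    weightedNorm s (x + y) ≤ weightedNorm s x + weightedNorm s y := by
  classical
  rw [weightedNorm_eq_sum (Finsupp.support_add (g₁ := x) (g₂ := y)),
    weightedNorm_eq_sum (Finset.subset_union_left (s₁ := x.support) (s₂ := y.support)),
    weightedNorm_eq_sum (Finset.subset_union_right (s₁ := x.support) (s₂ := y.support)),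
    ← Finset.sum_add_distrib]
  refine Finset.sum_le_sum fun k _ => ?_
  rw [← mul_add]
  exact mul_le_mul_of_nonneg_left (norm_add_le _ _) (by positivity)

theorem weightedNorm_smul (s : ℕ) (c : ℂ) (x : ℕ →₀ ℂ) :
    weightedNorm s (c • x) = ‖c‖ * weightedNorm s x := by
  rw [weightedNorm_eq_sum Finsupp.support_smul, weightedNorm_eq_sum subset_rfl, Finset.mul_sum]
  refine Finset.sum_congr rfl fun k _ => ?_
  rw [Finsupp.smul_apply, norm_smul]
  ring

theorem weightedNorm_mono {s t : ℕ} (h : s ≤ t) (x : ℕ →₀ ℂ) :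
    weightedNorm s x ≤ weightedNorm t x :=
  Finset.sum_le_sum fun k _ => mul_le_mul_of_nonneg_right
    (pow_le_pow_right₀ (by linarith [(Nat.cast_nonneg k : (0 : ℝ) ≤ k)]) h) (norm_nonneg _)

/-- To bound a linear map by a weighted norm, it suffices to do so on the basis vectors. -/
theorem le_mul_weightedNorm {V : Type*} [AddCommGroup V] [Module ℂ V] (p : Seminorm ℂ V)
    (a : (ℕ →₀ ℂ) →ₗ[ℂ] V) {C : ℝ} {t : ℕ}
    (h : ∀ n : ℕ, p (a (Finsupp.single n 1)) ≤ C * ((n : ℝ) + 1) ^ t) (x : ℕ →₀ ℂ) :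
    p (a x) ≤ C * weightedNorm t x := by
  have hx : a x = ∑ n ∈ x.support, x n • a (Finsupp.single n 1) := by
    conv_lhs => rw [← Finsupp.sum_single x, Finsupp.sum, map_sum]
    refine Finset.sum_congr rfl fun n _ => ?_
    rw [← map_smul, Finsupp.smul_single, smul_eq_mul, mul_one]
  rw [hx, weightedNorm, Finsupp.sum, Finset.mul_sum]
  refine (Finset.le_sum_of_subadditive p (map_zero p).le (map_add_le_add p) _ _).trans ?_
  refine Finset.sum_le_sum fun n _ => ?_
  rw [map_smul_eq_mul]
  calc ‖x n‖ * p (a (Finsupp.single n 1)) ≤ ‖x n‖ * (C * ((n : ℝ) + 1) ^ t) :=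
        mul_le_mul_of_nonneg_left (h n) (norm_nonneg _)
    _ = C * (((n : ℝ) + 1) ^ t * ‖x n‖) := by ring

/-- The weighted `ℓ¹` norms as seminorms. -/
def weightedSeminorm (s : ℕ) : Seminorm ℂ (ℕ →₀ ℂ) :=
  Seminorm.of (weightedNorm s) (weightedNorm_add_le s) (weightedNorm_smul s)

theorem weightedSeminorm_apply (s : ℕ) (x : ℕ →₀ ℂ) : weightedSeminorm s x = weightedNorm s x :=
  rfl

/-- A sequence of operators on finitely supported sequences that is uniformly bounded by weighted
norms, and converges in all weighted norms. -/
structure TameTendsto (a : ℕ → Module.End ℂ (ℕ →₀ ℂ)) (b : Module.End ℂ (ℕ →₀ ℂ)) : Prop where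
  bound : ∀ s, ∃ C t, 0 ≤ C ∧ ∀ M x, weightedNorm s (a M x) ≤ C * weightedNorm t x
  tendsto : ∀ s x, Tendsto (fun M => weightedNorm s (a M x - b x)) atTop (𝓝 0)

namespace TameTendsto

variable {a a' : ℕ → Module.End ℂ (ℕ →₀ ℂ)} {b b' : Module.End ℂ (ℕ →₀ ℂ)}

theorem algebraMap_const (c : ℂ) :
    TameTendsto (fun _ => algebraMap ℂ _ c) (algebraMap ℂ _ c) where
  bound s := ⟨‖c‖, s, norm_nonneg c, fun _ x => (weightedNorm_smul s c x).le⟩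
  tendsto s x := by simp [weightedNorm_zero]

theorem add (h : TameTendsto a b) (h' : TameTendsto a' b') :
    TameTendsto (fun M => a M + a' M) (b + b') where
  bound s := by
    obtain ⟨C, t, hC, ht⟩ := h.bound s
    obtain ⟨C', t', hC', ht'⟩ := h'.bound s
    refine ⟨C + C', max t t', add_nonneg hC hC', fun M x => ?_⟩
    rw [add_mul]
    refine (weightedNorm_add_le _ _ _).trans (add_le_add ((ht M x).trans ?_) ((ht' M x).trans ?_))
    · exact mul_le_mul_of_nonneg_left (weightedNorm_mono (le_max_left _ _) x) hC
    · exact mul_le_mul_of_nonneg_left (weightedNorm_mono (le_max_right _ _) x) hC'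
  tendsto s x := by
    have := (h.tendsto s x).add (h'.tendsto s x)
    rw [add_zero] at this
    refine squeeze_zero (fun _ => weightedNorm_nonneg _ _) (fun M => ?_) this
    simp only [LinearMap.add_apply, add_sub_add_comm]
    exact weightedNorm_add_le _ _ _

/-- Telescoping `a_M a'_M - b b' = a_M (a'_M - b') + (a_M - b) b'`: the uniform bound on `a_M`
controls the first term. Its loss of weight is harmless because convergence holds in every weighted
norm. -/
theorem mul (h : TameTendsto a b) (h' : TameTendsto a' b') :
    TameTendsto (fun M => a M * a' M) (b * b') where
  bound s := by
    obtain ⟨C, t, hC, ht⟩ := h.bound s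
    obtain ⟨C', t', hC', ht'⟩ := h'.bound t
    refine ⟨C * C', t', mul_nonneg hC hC', fun M x => (ht M _).trans ?_⟩
    rw [mul_assoc]
    exact mul_le_mul_of_nonneg_left (ht' M x) hC
  tendsto s x := by
    obtain ⟨C, t, hC, ht⟩ := h.bound s
    have := ((h'.tendsto t x).const_mul C).add (h.tendsto s (b' x))
    rw [add_zero, mul_zero] at this
    refine squeeze_zero (fun _ => weightedNorm_nonneg _ _) (fun M => ?_) this
    have he : (a M * a' M) x - (b * b') x = a M (a' M x - b' x) + (a M (b' x) - b (b' x)) := by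
      rw [map_sub, sub_add_sub_cancel]
      rfl
    rw [he]
    exact (weightedNorm_add_le _ _ _).trans (add_le_add (ht M _) le_rfl)

theorem evalPoly (h : TameTendsto a b) (h' : TameTendsto a' b') (f : FreeAlgebra ℂ (Fin 2)) :
    TameTendsto (fun M => evalPoly f (a M) (a' M)) (evalPoly f b b') := by
  unfold FluctuationOperators.evalPoly
  induction f using FreeAlgebra.induction with
  | grade0 c =>
    simp only [AlgHom.commutes]
    exact algebraMap_const c
  | grade1 i => fin_cases i <;> simpa
  | add f g hf hg => simpa using hf.add hg
  | mul f g hf hg => simpa using hf.mul hg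

theorem bound_limit (h : TameTendsto a b) (s : ℕ) :
    ∃ C t, 0 ≤ C ∧ ∀ x, weightedNorm s (b x) ≤ C * weightedNorm t x := by
  obtain ⟨C, t, hC, ht⟩ := h.bound s
  refine ⟨C, t, hC, fun x => ?_⟩
  have hlim := (h.tendsto s x).add_const (C * weightedNorm t x)
  rw [zero_add] at hlim
  refine ge_of_tendsto hlim (Eventually.of_forall fun M => ?_)
  have he : b x = (-1 : ℂ) • (a M x - b x) + a M x := by
    simp
  calc weightedNorm s (b x) ≤ weightedNorm s ((-1 : ℂ) • (a M x - b x)) + weightedNorm s (a M x) := by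
        conv_lhs => rw [he]
        exact weightedNorm_add_le _ _ _
    _ ≤ _ := by
        rw [weightedNorm_smul, norm_neg, norm_one, one_mul]
        exact add_le_add le_rfl (ht M x)

end TameTendsto

/-- The operator `e n ↦ q v(n + 1) e (n + 1) + p v(n) e (n - 1)`. -/
def ladder (v : ℕ → ℝ) (p q : ℂ) : Module.End ℂ (ℕ →₀ ℂ) :=
  Finsupp.linearCombination ℂ fun n =>
    Finsupp.single (n + 1) (q * (v (n + 1) : ℂ)) + Finsupp.single (n - 1) (p * (v n : ℂ))

theorem ladder_single (v : ℕ → ℝ) (p q : ℂ) (n : ℕ) : ladder v p q (Finsupp.single n 1) =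
    Finsupp.single (n + 1) (q * (v (n + 1) : ℂ)) + Finsupp.single (n - 1) (p * (v n : ℂ)) := by
  rw [ladder, Finsupp.linearCombination_single, one_smul]

theorem tameTendsto_ladder {v : ℕ → ℕ → ℝ} {w : ℕ → ℝ} (hv : ∀ M n, |v M n| ≤ Real.sqrt n)
    (hvw : ∀ n, Tendsto (fun M => v M n) atTop (𝓝 (w n))) {p q : ℂ} (hp : ‖p‖ ≤ 1)
    (hq : ‖q‖ ≤ 1) : TameTendsto (fun M => ladder (v M) p q) (ladder w p q) where
  bound s := by
    -- One power of the weight pays for the coefficient, via `√n ≤ n`. Raising costs `2 ^ s`, since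
    -- `n + 2 ≤ 2 (n + 1)`; lowering costs `1`.
    refine ⟨2 ^ s + 1, s + 1, by positivity, fun M x => le_mul_weightedNorm (weightedSeminorm s)
      (ladder (v M) p q) (fun n => ?_) x⟩
    have hvn : ∀ n, |v M n| ≤ n := fun n => by
      refine (hv M n).trans (Real.sqrt_le_iff.mpr ⟨Nat.cast_nonneg n, ?_⟩)
      exact_mod_cast Nat.le_self_pow two_ne_zero n
    have hn : (0 : ℝ) ≤ n := Nat.cast_nonneg n
    rw [ladder_single, weightedSeminorm_apply]
    refine (weightedNorm_add_le _ _ _).trans ?_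
    rw [weightedNorm_single, weightedNorm_single, norm_mul, norm_mul, Complex.norm_real,
      Complex.norm_real, Real.norm_eq_abs, Real.norm_eq_abs, add_mul]
    refine add_le_add ?_ ?_
    · calc (((n + 1 : ℕ) : ℝ) + 1) ^ s * (‖q‖ * |v M (n + 1)|)
          ≤ (2 * ((n : ℝ) + 1)) ^ s * (1 * ((n : ℝ) + 1)) := by
            have := hvn (n + 1)
            push_cast at this ⊢
            gcongr
            linarith
        _ = 2 ^ s * ((n : ℝ) + 1) ^ (s + 1) := by rw [mul_pow, one_mul, pow_succ, mul_assoc]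
    · calc (((n - 1 : ℕ) : ℝ) + 1) ^ s * (‖p‖ * |v M n|)
          ≤ ((n : ℝ) + 1) ^ s * (1 * ((n : ℝ) + 1)) := by
            have h1 := hvn n
            have h2 : ((n - 1 : ℕ) : ℝ) ≤ n := by exact_mod_cast Nat.sub_le n 1
            gcongr
            linarith
        _ = 1 * ((n : ℝ) + 1) ^ (s + 1) := by ring
  tendsto s x := by
    induction x using Finsupp.induction_linear with
    | zero => simp [weightedNorm_zero]
    | add x y hx hy =>
      have := hx.add hy
      rw [add_zero] at this
      refine squeeze_zero (fun _ => weightedNorm_nonneg _ _) (fun M => ?_) this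
      rw [map_add, map_add, add_sub_add_comm]
      exact weightedNorm_add_le _ _ _
    | single n z =>
      have hd : ∀ m, Tendsto (fun M => ‖((v M m : ℂ) - w m)‖) atTop (𝓝 0) := fun m => by
        have := ((hvw m).sub_const (w m)).norm
        rw [sub_self, norm_zero] at this
        refine this.congr fun M => ?_
        rw [← Complex.ofReal_sub, Complex.norm_real]
      have h := (((hd (n + 1)).const_mul ((((n + 1 : ℕ) : ℝ) + 1) ^ s * ‖q‖)).add
        ((hd n).const_mul ((((n - 1 : ℕ) : ℝ) + 1) ^ s * ‖p‖))).const_mul ‖z‖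
      simp only [mul_zero, add_zero] at h
      refine squeeze_zero (fun _ => weightedNorm_nonneg _ _) (fun M => ?_) h
      have he : Finsupp.single n z = z • Finsupp.single n (1 : ℂ) := by simp
      have he' : ladder (v M) p q (Finsupp.single n z) - ladder w p q (Finsupp.single n z) =
          z • (Finsupp.single (n + 1) (q * ((v M (n + 1) : ℂ) - w (n + 1))) +
            Finsupp.single (n - 1) (p * ((v M n : ℂ) - w n))) := by
        rw [he, map_smul, map_smul, ladder_single, ladder_single, ← smul_sub, add_sub_add_comm,
          ← Finsupp.single_sub, ← Finsupp.single_sub, mul_sub, mul_sub]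
      rw [he', weightedNorm_smul]
      refine mul_le_mul_of_nonneg_left ((weightedNorm_add_le _ _ _).trans_eq ?_) (norm_nonneg z)
      rw [weightedNorm_single, weightedNorm_single, norm_mul, norm_mul]
      ring

/-- Polynomials in two operators respect intertwining maps. -/
theorem evalPoly_intertwine {V : Type*} [AddCommGroup V] [Module ℂ V] [TopologicalSpace V]
    [IsTopologicalAddGroup V] [ContinuousConstSMul ℂ V] {W : Type*} [AddCommGroup W] [Module ℂ W]
    (J : W →ₗ[ℂ] V) {X Y : V →L[ℂ] V} {x y : Module.End ℂ W} (hX : ∀ e, X (J e) = J (x e))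
    (hY : ∀ e, Y (J e) = J (y e)) (f : FreeAlgebra ℂ (Fin 2)) (e : W) :
    evalPoly f X Y (J e) = J (evalPoly f x y e) := by
  unfold evalPoly
  induction f using FreeAlgebra.induction generalizing e with
  | grade0 c => simp [Algebra.algebraMap_eq_smul_one]
  | grade1 i => fin_cases i <;> simp [hX, hY]
  | add f g hf hg => simp [hf, hg]
  | mul f g hf hg => simp [hf, hg]

end Ladder

/-! ### Hermite expansions of Schwartz functions -/

section HermiteExpansion

/-- Finite linear combinations of Hermite functions, as Schwartz functions. -/
def hermiteComb : (ℕ →₀ ℂ) →ₗ[ℂ] 𝓢(ℝ, ℂ) := Finsupp.linearCombination ℂ hermiteFun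

theorem hermiteComb_single (n : ℕ) (z : ℂ) :
    hermiteComb (Finsupp.single n z) = z • hermiteFun n :=
  Finsupp.linearCombination_single ℂ z n

/-- Finite linear combinations of Hermite functions, as elements of `L²(ℝ)`. -/
def hermiteCombL2 : (ℕ →₀ ℂ) →ₗ[ℂ] L2R := (incl : 𝓢(ℝ, ℂ) →ₗ[ℂ] L2R) ∘ₗ hermiteComb

theorem hermiteCombL2_apply (x : ℕ →₀ ℂ) : hermiteCombL2 x = incl (hermiteComb x) := rfl

/-- The position operator in the Hermite basis. -/
def positionMatrix : Module.End ℂ (ℕ →₀ ℂ) :=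
  ladder (fun n => Real.sqrt n) invSqrtTwo invSqrtTwo

/-- The momentum operator in the Hermite basis. -/
def momentumMatrix : Module.End ℂ (ℕ →₀ ℂ) :=
  ladder (fun n => Real.sqrt n) (-Complex.I * invSqrtTwo) (Complex.I * invSqrtTwo)

theorem position_hermiteComb (x : ℕ →₀ ℂ) :
    position (hermiteComb x) = hermiteComb (positionMatrix x) := by
  change ((position : 𝓢(ℝ, ℂ) →ₗ[ℂ] 𝓢(ℝ, ℂ)) ∘ₗ hermiteComb) x = (hermiteComb ∘ₗ positionMatrix) x
  congr 1
  refine Finsupp.lhom_ext' fun n => LinearMap.ext_ring ?_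
  change position (hermiteComb (Finsupp.single n 1)) =
    hermiteComb (positionMatrix (Finsupp.single n 1))
  rw [positionMatrix, ladder_single, map_add, hermiteComb_single, hermiteComb_single,
    hermiteComb_single, one_smul, position_hermiteFun]

theorem momentum_hermiteComb (x : ℕ →₀ ℂ) :
    momentum (hermiteComb x) = hermiteComb (momentumMatrix x) := by
  change ((momentum : 𝓢(ℝ, ℂ) →ₗ[ℂ] 𝓢(ℝ, ℂ)) ∘ₗ hermiteComb) x = (hermiteComb ∘ₗ momentumMatrix) x
  congr 1
  refine Finsupp.lhom_ext' fun n => LinearMap.ext_ring ?_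
  change momentum (hermiteComb (Finsupp.single n 1)) =
    hermiteComb (momentumMatrix (Finsupp.single n 1))
  rw [momentumMatrix, ladder_single, map_add, hermiteComb_single, hermiteComb_single,
    hermiteComb_single, one_smul, momentum_hermiteFun]

theorem fluctQ_hermiteCombL2 (M : ℕ) (x : ℕ →₀ ℂ) :
    fluctQ M (hermiteCombL2 x) =
      hermiteCombL2 (ladder (spinCoeff M) invSqrtTwo invSqrtTwo x) := by
  change ((fluctQ M : L2R →ₗ[ℂ] L2R) ∘ₗ hermiteCombL2) x =
    (hermiteCombL2 ∘ₗ ladder (spinCoeff M) invSqrtTwo invSqrtTwo) x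
  congr 1
  refine Finsupp.lhom_ext' fun n => LinearMap.ext_ring ?_
  change fluctQ M (hermiteCombL2 (Finsupp.single n 1)) =
    hermiteCombL2 (ladder (spinCoeff M) invSqrtTwo invSqrtTwo (Finsupp.single n 1))
  rw [ladder_single, map_add, hermiteCombL2_apply, hermiteCombL2_apply, hermiteCombL2_apply,
    hermiteComb_single, hermiteComb_single, hermiteComb_single, one_smul, fluctQ_hermiteFun,
    map_smul, map_smul]

theorem fluctP_hermiteCombL2 (M : ℕ) (x : ℕ →₀ ℂ) :
    fluctP M (hermiteCombL2 x) = hermiteCombL2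
      (ladder (spinCoeff M) (-Complex.I * invSqrtTwo) (Complex.I * invSqrtTwo) x) := by
  change ((fluctP M : L2R →ₗ[ℂ] L2R) ∘ₗ hermiteCombL2) x =
    (hermiteCombL2 ∘ₗ
      ladder (spinCoeff M) (-Complex.I * invSqrtTwo) (Complex.I * invSqrtTwo)) x
  congr 1
  refine Finsupp.lhom_ext' fun n => LinearMap.ext_ring ?_
  change fluctP M (hermiteCombL2 (Finsupp.single n 1)) = hermiteCombL2
    (ladder (spinCoeff M) (-Complex.I * invSqrtTwo) (Complex.I * invSqrtTwo) (Finsupp.single n 1))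
  rw [ladder_single, map_add, hermiteCombL2_apply, hermiteCombL2_apply, hermiteCombL2_apply,
    hermiteComb_single, hermiteComb_single, hermiteComb_single, one_smul, fluctP_hermiteFun,
    map_smul, map_smul]

theorem norm_hermiteCombL2_le (x : ℕ →₀ ℂ) : ‖hermiteCombL2 x‖ ≤ weightedNorm 0 x := by
  have h := le_mul_weightedNorm (C := 1) (t := 0) (normSeminorm ℂ L2R) hermiteCombL2 (fun n => by
    rw [hermiteCombL2_apply, hermiteComb_single, one_smul]
    simpa using (orthonormal_hermiteFun.1 n).le) x
  rwa [one_mul] at h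

theorem tameTendsto_fluct (f : FreeAlgebra ℂ (Fin 2)) :
    TameTendsto (fun M => evalPoly f (ladder (spinCoeff M) invSqrtTwo invSqrtTwo)
      (ladder (spinCoeff M) (-Complex.I * invSqrtTwo) (Complex.I * invSqrtTwo)))
      (evalPoly f positionMatrix momentumMatrix) := by
  have hv : ∀ M n, |spinCoeff M n| ≤ Real.sqrt n := fun M n => by
    rw [abs_of_nonneg (spinCoeff_nonneg M n)]
    exact spinCoeff_le M n
  refine TameTendsto.evalPoly (tameTendsto_ladder hv tendsto_spinCoeff norm_invSqrtTwo_le_one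
    norm_invSqrtTwo_le_one) (tameTendsto_ladder hv tendsto_spinCoeff ?_ ?_) f
  · simpa using norm_invSqrtTwo_le_one
  · simpa using norm_invSqrtTwo_le_one

theorem evalPoly_fluct_hermiteFun (f : FreeAlgebra ℂ (Fin 2)) (M n : ℕ) :
    evalPoly f (fluctQ M) (fluctP M) (incl (hermiteFun n)) =
      hermiteCombL2 (evalPoly f (ladder (spinCoeff M) invSqrtTwo invSqrtTwo)
        (ladder (spinCoeff M) (-Complex.I * invSqrtTwo) (Complex.I * invSqrtTwo))
        (Finsupp.single n 1)) := by
  rw [← evalPoly_intertwine hermiteCombL2 (fluctQ_hermiteCombL2 M) (fluctP_hermiteCombL2 M),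
    hermiteCombL2_apply, hermiteComb_single, one_smul]

theorem evalPoly_hermiteComb (f : FreeAlgebra ℂ (Fin 2)) (x : ℕ →₀ ℂ) :
    evalPoly f position momentum (hermiteComb x) =
      hermiteComb (evalPoly f positionMatrix momentumMatrix x) :=
  evalPoly_intertwine hermiteComb position_hermiteComb momentum_hermiteComb f x

/-- The constants do not depend on `M`, which supplies the dominating series in the final limit. -/
theorem exists_bound_evalPoly_fluct (f : FreeAlgebra ℂ (Fin 2)) :
    ∃ C t, 0 ≤ C ∧ ∀ M n : ℕ, ‖evalPoly f (fluctQ M) (fluctP M) (incl (hermiteFun n))‖ ≤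
      C * ((n : ℝ) + 1) ^ t := by
  obtain ⟨C, t, hC, h⟩ := (tameTendsto_fluct f).bound 0
  refine ⟨C, t, hC, fun M n => ?_⟩
  rw [evalPoly_fluct_hermiteFun]
  refine (norm_hermiteCombL2_le _).trans ((h M _).trans_eq ?_)
  rw [weightedNorm_single, norm_one, mul_one]

theorem exists_bound_evalPoly (f : FreeAlgebra ℂ (Fin 2)) :
    ∃ C t, 0 ≤ C ∧ ∀ x, ‖incl (evalPoly f position momentum (hermiteComb x))‖ ≤
      C * weightedNorm t x := by
  obtain ⟨C, t, hC, h⟩ := (tameTendsto_fluct f).bound_limit 0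
  refine ⟨C, t, hC, fun x => ?_⟩
  rw [evalPoly_hermiteComb]
  exact (norm_hermiteCombL2_le _).trans (h x)

theorem tendsto_evalPoly_fluct (f : FreeAlgebra ℂ (Fin 2)) (n : ℕ) :
    Tendsto (fun M => evalPoly f (fluctQ M) (fluctP M) (incl (hermiteFun n))) atTop
      (𝓝 (incl (evalPoly f position momentum (hermiteFun n)))) := by
  have h := (tameTendsto_fluct f).tendsto 0 (Finsupp.single n 1)
  rw [tendsto_iff_norm_sub_tendsto_zero]
  refine squeeze_zero (fun _ => norm_nonneg _) (fun M => ?_) h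
  have he : hermiteFun n = hermiteComb (Finsupp.single n 1) := by
    rw [hermiteComb_single, one_smul]
  rw [evalPoly_fluct_hermiteFun, he, evalPoly_hermiteComb, ← hermiteCombL2_apply, ← map_sub]
  exact norm_hermiteCombL2_le _

end HermiteExpansion

/-! ### Convergence in the Schwartz space -/

section SchwartzSpace

theorem norm_incl_sq (ψ : 𝓢(ℝ, ℂ)) : ‖incl ψ‖ ^ 2 = ∫ x, ‖ψ x‖ ^ 2 := by
  have h := inner_self_eq_norm_sq_to_K (𝕜 := ℂ) (incl ψ)
  rw [inner_incl] at h
  have h2 : ∀ x, (starRingEnd ℂ) (ψ x) * ψ x = ((‖ψ x‖ ^ 2 : ℝ) : ℂ) := fun x => by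
    rw [Complex.conj_mul']
    push_cast
    rfl
  simp_rw [h2] at h
  rw [integral_complex_ofReal] at h
  refine (Complex.ofReal_injective (h.trans ?_)).symm
  simp

theorem integrable_norm_sq (ψ : 𝓢(ℝ, ℂ)) : Integrable fun x => ‖ψ x‖ ^ 2 :=
  (memLp_two_iff_integrable_sq_norm ψ.continuous.aestronglyMeasurable).mp (ψ.memLp 2 volume)

/-- One-dimensional Sobolev inequality: `|ψ|²` at `x` is the integral of its derivative over `(-∞,
x]`, bounded by `‖ψ‖² + ‖ψ'‖²`. -/
theorem norm_apply_le (ψ : 𝓢(ℝ, ℂ)) (x : ℝ) : ‖ψ x‖ ≤ ‖incl ψ‖ + ‖incl (momentum ψ)‖ := by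
  set F : ℝ → ℂ := fun y => conjSchwartz ψ y * ψ y
  set F' : ℝ → ℂ := fun y => deriv (conjSchwartz ψ) y * ψ y + conjSchwartz ψ y * deriv ψ y
  have hF : ∀ y, HasDerivAt F (F' y) y := fun y =>
    ((conjSchwartz ψ).hasDerivAt y).mul (ψ.hasDerivAt y)
  have hF'c : Continuous F' := by
    have h1 : Continuous (deriv ψ) := (SchwartzMap.derivCLM ℂ ℂ ψ).continuous
    have h2 : Continuous (deriv (conjSchwartz ψ)) :=
      (SchwartzMap.derivCLM ℂ ℂ (conjSchwartz ψ)).continuous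
    exact (h2.mul ψ.continuous).add ((conjSchwartz ψ).continuous.mul h1)
  have hbound : ∀ y, ‖F' y‖ ≤ ‖ψ y‖ ^ 2 + ‖momentum ψ y‖ ^ 2 := fun y => by
    have h1 : ‖momentum ψ y‖ = ‖deriv ψ y‖ := by
      rw [momentum_apply, norm_mul, norm_neg, Complex.norm_I, one_mul]
    have h2 : ‖F' y‖ ≤ ‖deriv ψ y‖ * ‖ψ y‖ + ‖ψ y‖ * ‖deriv ψ y‖ := by
      refine (norm_add_le _ _).trans_eq ?_
      rw [norm_mul, norm_mul, deriv_conjSchwartz, conjSchwartz_apply, RCLike.norm_conj,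
        RCLike.norm_conj]
    rw [h1]
    nlinarith [sq_nonneg (‖ψ y‖ - ‖deriv ψ y‖)]
  have hint := (integrable_norm_sq ψ).add (integrable_norm_sq (momentum ψ))
  have hF'i : Integrable F' :=
    hint.mono' hF'c.aestronglyMeasurable (Eventually.of_forall hbound)
  have hlim : Tendsto F atBot (𝓝 0) := by
    have h1 : Tendsto ψ atBot (𝓝 0) :=
      (zero_at_infty ψ).mono_left atBot_le_cocompact
    have h2 : Tendsto (conjSchwartz ψ) atBot (𝓝 0) :=
      (zero_at_infty (conjSchwartz ψ)).mono_left atBot_le_cocompact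
    simpa using h2.mul h1
  have hFx : ∫ y in Set.Iic x, F' y = F x - 0 :=
    integral_Iic_of_hasDerivAt_of_tendsto' (fun y _ => hF y) hF'i.integrableOn hlim
  have hle : ‖ψ x‖ ^ 2 ≤ ‖incl ψ‖ ^ 2 + ‖incl (momentum ψ)‖ ^ 2 := by
    calc ‖ψ x‖ ^ 2 = ‖F x‖ := by
          rw [norm_mul, conjSchwartz_apply, RCLike.norm_conj, sq]
      _ = ‖∫ y in Set.Iic x, F' y‖ := by rw [hFx, sub_zero]
      _ ≤ ∫ y in Set.Iic x, ‖F' y‖ := norm_integral_le_integral_norm _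
      _ ≤ ∫ y, ‖F' y‖ := setIntegral_le_integral hF'i.norm
          (Eventually.of_forall fun y => norm_nonneg _)
      _ ≤ ∫ y, (‖ψ y‖ ^ 2 + ‖momentum ψ y‖ ^ 2) := integral_mono hF'i.norm hint hbound
      _ = _ := by
          rw [integral_add (integrable_norm_sq ψ) (integrable_norm_sq _), norm_incl_sq,
            norm_incl_sq]
  refine le_of_sq_le_sq ?_ (by positivity)
  nlinarith [mul_nonneg (norm_nonneg (incl ψ)) (norm_nonneg (incl (momentum ψ)))]

theorem iteratedDeriv_eq_momentum_pow (n : ℕ) (ψ : 𝓢(ℝ, ℂ)) :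
    iteratedDeriv n ψ = fun x => Complex.I ^ n * (momentum ^ n) ψ x := by
  induction n with
  | zero => simp
  | succ n ih =>
    rw [iteratedDeriv_succ, ih]
    funext x
    rw [deriv_const_mul _ ((momentum ^ n) ψ).differentiableAt, pow_succ' momentum,
      mul_apply_eq_comp, momentum_apply]
    linear_combination (Complex.I ^ n * deriv ((momentum ^ n) ψ) x) * Complex.I_mul_I

/-- By the Sobolev bound, the supremum of `|x^k ∂^l ψ|` is controlled by the `L²` norms of `Q^k P^l
ψ` and `P Q^k P^l ψ`, both values of noncommutative polynomials. -/
theorem exists_bound_seminorm_hermiteComb (k l : ℕ) :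
    ∃ C t, 0 ≤ C ∧ ∀ x, SchwartzMap.seminorm ℂ k l (hermiteComb x) ≤ C * weightedNorm t x := by
  set f : FreeAlgebra ℂ (Fin 2) := FreeAlgebra.ι ℂ 0 ^ k * FreeAlgebra.ι ℂ 1 ^ l
  have hf : evalPoly f position momentum = position ^ k * momentum ^ l := by
    simp [f, evalPoly]
  have hg : evalPoly (FreeAlgebra.ι ℂ 1 * f) position momentum =
      momentum * (position ^ k * momentum ^ l) := by
    rw [← hf]
    simp [evalPoly]
  obtain ⟨C₁, t₁, hC₁, h₁⟩ := exists_bound_evalPoly f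
  obtain ⟨C₂, t₂, hC₂, h₂⟩ := exists_bound_evalPoly (FreeAlgebra.ι ℂ 1 * f)
  refine ⟨C₁ + C₂, max t₁ t₂, add_nonneg hC₁ hC₂, fun x => ?_⟩
  refine SchwartzMap.seminorm_le_bound' ℂ k l _
    (mul_nonneg (add_nonneg hC₁ hC₂) (weightedNorm_nonneg _ _)) fun y => ?_
  have hy : |y| ^ k * ‖iteratedDeriv l (hermiteComb x) y‖ =
      ‖(position ^ k * momentum ^ l) (hermiteComb x) y‖ := by
    rw [iteratedDeriv_eq_momentum_pow, mul_apply_eq_comp, position_pow_apply, norm_mul, norm_mul,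
      norm_pow, norm_pow, Complex.norm_I, one_pow, one_mul, Complex.norm_real, Real.norm_eq_abs]
  have h1 := h₁ x
  have h2 := h₂ x
  rw [hf] at h1
  rw [hg, mul_apply_eq_comp] at h2
  rw [hy, add_mul]
  refine (norm_apply_le _ y).trans (add_le_add (h1.trans ?_) (h2.trans ?_))
  · exact mul_le_mul_of_nonneg_left (weightedNorm_mono (le_max_left _ _) x) hC₁
  · exact mul_le_mul_of_nonneg_left (weightedNorm_mono (le_max_right _ _) x) hC₂

theorem exists_bound_seminorm_hermiteFun (k l : ℕ) :
    ∃ C t, 0 ≤ C ∧ ∀ n : ℕ, SchwartzMap.seminorm ℂ k l (hermiteFun n) ≤ C * ((n : ℝ) + 1) ^ t := by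
  obtain ⟨C, t, hC, h⟩ := exists_bound_seminorm_hermiteComb k l
  refine ⟨C, t, hC, fun n => ?_⟩
  simpa [hermiteComb_single, weightedNorm_single] using h (Finsupp.single n 1)

/-- A series that converges absolutely in all Schwartz seminorms converges in the Schwartz
space. -/
theorem exists_hasSum_schwartz {F : ℕ → 𝓢(ℝ, ℂ)}
    (h : ∀ k l, Summable fun n => SchwartzMap.seminorm ℂ k l (F n)) : ∃ η, HasSum F η := by
  have hb : ∀ (k l n : ℕ) (x : ℝ), ‖x‖ ^ k * ‖iteratedFDeriv ℝ l (F n) x‖ ≤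
      SchwartzMap.seminorm ℂ k l (F n) := fun k l n x => SchwartzMap.le_seminorm ℂ k l (F n) x
  have hb0 : ∀ (l n : ℕ) (x : ℝ), (l : ℕ∞) ≤ (⊤ : ℕ∞) → ‖iteratedFDeriv ℝ l (F n) x‖ ≤
      SchwartzMap.seminorm ℂ 0 l (F n) := fun l n x _ => by simpa using hb 0 l n x
  have hsm : ∀ n, ContDiff ℝ ((⊤ : ℕ∞) : WithTop ℕ∞) (F n) := fun n => (F n).smooth ⊤
  have hder : ∀ (l : ℕ) (x : ℝ), Summable fun n => iteratedFDeriv ℝ l (F n) x := fun l x =>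
    Summable.of_norm_bounded (h 0 l) fun n => hb0 l n x le_top
  -- This tail estimate serves twice: `s = ∅` gives the decay of the limit function, general `s`
  -- gives convergence in each seminorm.
  have htail : ∀ (k l : ℕ) (s : Finset ℕ) (x : ℝ),
      ‖x‖ ^ k * ‖∑' n, iteratedFDeriv ℝ l (F n) x - ∑ n ∈ s, iteratedFDeriv ℝ l (F n) x‖ ≤
        ∑' n, SchwartzMap.seminorm ℂ k l (F n) - ∑ n ∈ s, SchwartzMap.seminorm ℂ k l (F n) :=
      fun k l s x => by
    rw [← (hder l x).sum_add_tsum_subtype_compl s, ← (h k l).sum_add_tsum_subtype_compl s,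
      add_sub_cancel_left, add_sub_cancel_left]
    have hs : Summable fun n : {n // n ∉ s} => ‖iteratedFDeriv ℝ l (F n) x‖ :=
      ((h 0 l).subtype _).of_nonneg_of_le (fun _ => norm_nonneg _) fun n => hb0 l n x le_top
    calc ‖x‖ ^ k * ‖∑' n : {n // n ∉ s}, iteratedFDeriv ℝ l (F n) x‖
        ≤ ‖x‖ ^ k * ∑' n : {n // n ∉ s}, ‖iteratedFDeriv ℝ l (F n) x‖ :=
          mul_le_mul_of_nonneg_left (norm_tsum_le_tsum_norm hs) (by positivity)
      _ = ∑' n : {n // n ∉ s}, ‖x‖ ^ k * ‖iteratedFDeriv ℝ l (F n) x‖ := tsum_mul_left.symm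
      _ ≤ _ := Summable.tsum_le_tsum (fun n => hb k l n x) (hs.mul_left _) ((h k l).subtype _)
  have hiter : ∀ l : ℕ, iteratedFDeriv ℝ l (fun x => ∑' n, F n x) =
      fun x => ∑' n, iteratedFDeriv ℝ l (F n) x := fun l =>
    iteratedFDeriv_tsum hsm (fun l _ => h 0 l) hb0 le_top
  let η : 𝓢(ℝ, ℂ) :=
    { toFun := fun x => ∑' n, F n x
      smooth' := contDiff_tsum hsm (fun l _ => h 0 l) hb0
      decay' := fun k l => ⟨∑' n, SchwartzMap.seminorm ℂ k l (F n), fun x => by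
        rw [hiter l]
        simpa using htail k l ∅ x⟩ }
  refine ⟨η, ((schwartz_withSeminorms ℂ ℝ ℂ).tendsto_nhds _ η).mpr fun kl ε hε => ?_⟩
  obtain ⟨k, l⟩ := kl
  have hconv : Tendsto (fun s : Finset ℕ => ∑' n, SchwartzMap.seminorm ℂ k l (F n) -
      ∑ n ∈ s, SchwartzMap.seminorm ℂ k l (F n)) atTop (𝓝 0) := by
    simpa using (tendsto_const_nhds (x := ∑' n, SchwartzMap.seminorm ℂ k l (F n))).sub
      (h k l).hasSum
  filter_upwards [hconv.eventually (gt_mem_nhds hε)] with s hs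
  refine lt_of_le_of_lt ?_ hs
  rw [map_sub_rev]
  refine SchwartzMap.seminorm_le_bound ℂ k l _ ?_ fun x => ?_
  · rw [← (h k l).sum_add_tsum_subtype_compl s, add_sub_cancel_left]
    exact tsum_nonneg fun _ => apply_nonneg _ _
  · refine le_trans (le_of_eq ?_) (htail k l s x)
    congr 2
    have hη : ∀ y, η y = ∑' n, F n y := fun _ => rfl
    have hηs : ContDiff ℝ l fun x => ∑' n, F n x := η.smooth l
    have hcoe : ((η - ∑ n ∈ s, F n : 𝓢(ℝ, ℂ)) : ℝ → ℂ) =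
        (fun x => ∑' n, F n x) - fun x => ∑ n ∈ s, F n x := by
      funext y
      simp [hη]
    have hsum : ContDiff ℝ l fun x => ∑ n ∈ s, F n x :=
      ContDiff.sum fun n _ => (F n).smooth l
    rw [hcoe, iteratedFDeriv_sub_apply hηs.contDiffAt hsum.contDiffAt, hiter l,
      iteratedFDeriv_fun_sum_apply fun n _ => ((F n).smooth l).contDiffAt]

end SchwartzSpace

/-! ### Decay of the matrix elements of Schwartz operators -/

section SchwartzOperators

theorem position_momentum_comm :
    position * momentum = momentum * position + algebraMap ℂ (𝓢(ℝ, ℂ) →L[ℂ] 𝓢(ℝ, ℂ)) Complex.I := by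
  ext ψ x
  have h : deriv (position ψ) x = ψ x + (x : ℂ) * deriv ψ x := by
    have h1 : (position ψ : ℝ → ℂ) = fun y : ℝ => (y : ℂ) * ψ y := funext (position_apply ψ)
    rw [h1]
    exact ((hasDerivAt_id x).ofReal_comp.mul (ψ.hasDerivAt x)).deriv.trans (by simp)
  rw [Algebra.algebraMap_eq_smul_one, mul_apply_eq_comp, add_apply, mul_apply_eq_comp, smul_apply,
    one_apply_eq_self, position_apply, add_apply, smul_apply, momentum_apply, momentum_apply, h,
    smul_eq_mul]
  ring

/-- The span of the normally ordered monomials `P^β Q^α`. -/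
def normalOrdered : Submodule ℂ (𝓢(ℝ, ℂ) →L[ℂ] 𝓢(ℝ, ℂ)) :=
  Submodule.span ℂ (Set.range fun k : ℕ × ℕ => momentum ^ k.2 * position ^ k.1)

theorem monomial_mem_normalOrdered (α β : ℕ) :
    momentum ^ β * position ^ α ∈ normalOrdered := Submodule.subset_span ⟨(α, β), rfl⟩

theorem mul_mem_normalOrdered {B : 𝓢(ℝ, ℂ) →L[ℂ] 𝓢(ℝ, ℂ)}
    (h : ∀ α β, B * (momentum ^ β * position ^ α) ∈ normalOrdered)
    {A : 𝓢(ℝ, ℂ) →L[ℂ] 𝓢(ℝ, ℂ)} (hA : A ∈ normalOrdered) : B * A ∈ normalOrdered := by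
  rw [normalOrdered] at hA
  induction hA using Submodule.span_induction with
  | mem A hA =>
    obtain ⟨k, rfl⟩ := hA
    exact h k.1 k.2
  | zero => simp
  | add A A' _ _ hA hA' =>
    rw [mul_add]
    exact Submodule.add_mem _ hA hA'
  | smul c A _ hA =>
    rw [mul_smul_comm]
    exact Submodule.smul_mem _ _ hA

theorem momentum_mul_mem {A : 𝓢(ℝ, ℂ) →L[ℂ] 𝓢(ℝ, ℂ)} (hA : A ∈ normalOrdered) :
    momentum * A ∈ normalOrdered :=
  mul_mem_normalOrdered (fun α β => by
    rw [← mul_assoc, ← pow_succ']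
    exact monomial_mem_normalOrdered α (β + 1)) hA

/-- Commuting `Q` past one `P` leaves `i` times a monomial with one `P` fewer, so induction on `β`
closes. -/
theorem position_mul_mem {A : 𝓢(ℝ, ℂ) →L[ℂ] 𝓢(ℝ, ℂ)} (hA : A ∈ normalOrdered) :
    position * A ∈ normalOrdered := by
  refine mul_mem_normalOrdered (fun α β => ?_) hA
  induction β with
  | zero =>
    have h : position * (momentum ^ 0 * position ^ α) = momentum ^ 0 * position ^ (α + 1) := by
      rw [pow_zero, one_mul, one_mul, pow_succ']
    rw [h]
    exact monomial_mem_normalOrdered (α + 1) 0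
  | succ β ih =>
    have h : position * (momentum ^ (β + 1) * position ^ α) =
        momentum * (position * (momentum ^ β * position ^ α)) +
          Complex.I • (momentum ^ β * position ^ α) := by
      rw [pow_succ', mul_assoc, ← mul_assoc position, position_momentum_comm, add_mul, mul_assoc,
        ← Algebra.smul_def]
    rw [h]
    exact Submodule.add_mem _ (momentum_mul_mem ih)
      (Submodule.smul_mem _ _ (monomial_mem_normalOrdered α β))

theorem oscillator_pow_mem (k : ℕ) : oscillator ^ k ∈ normalOrdered := by
  induction k with
  | zero => simpa using monomial_mem_normalOrdered 0 0
  | succ k ih =>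
    rw [pow_succ', oscillator, smul_mul_assoc, add_mul, add_mul, one_mul, mul_assoc, mul_assoc]
    exact Submodule.smul_mem _ _ (Submodule.add_mem _ (Submodule.add_mem _
      (momentum_mul_mem (momentum_mul_mem ih)) (position_mul_mem (position_mul_mem ih))) ih)

theorem sup_seminorm_mono {s t : Finset (ℕ × ℕ × ℕ × ℕ)} (h : s ⊆ t) (T : SchwartzOperator) :
    s.sup schwartzOperatorSeminorm T ≤ t.sup schwartzOperatorSeminorm T :=
  Finset.sup_mono (f := schwartzOperatorSeminorm) h T

theorem exists_bound_of_mem_normalOrdered {A : 𝓢(ℝ, ℂ) →L[ℂ] 𝓢(ℝ, ℂ)}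
    (hA : A ∈ normalOrdered) :
    ∃ (C : ℝ) (s : Finset (ℕ × ℕ × ℕ × ℕ)), 0 ≤ C ∧ ∀ (T : SchwartzOperator) (ψ φ : 𝓢(ℝ, ℂ)),
      ‖incl ψ‖ ≤ 1 → ‖incl φ‖ ≤ 1 →
        ‖⟪incl (A ψ), T.toCLM (incl φ)⟫_ℂ‖ ≤ C * s.sup schwartzOperatorSeminorm T := by
  classical
  rw [normalOrdered] at hA
  induction hA using Submodule.span_induction with
  | mem A hA =>
    obtain ⟨⟨α, β⟩, rfl⟩ := hA
    -- Only operators on the left vector occur, so the seminorms with `α' = β' = 0` suffice.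
    refine ⟨1, {(α, 0, β, 0)}, zero_le_one, fun T ψ φ hψ hφ => ?_⟩
    rw [one_mul, Finset.sup_singleton]
    exact le_csSup (T.2 (α, 0, β, 0)) ⟨ψ, φ, hψ, hφ, by simp⟩
  | zero => exact ⟨0, ∅, le_rfl, fun T ψ φ _ _ => by simp only [map_zero, zero_apply]; simp⟩
  | add A A' _ _ hA hA' =>
    obtain ⟨C, s, hC, h⟩ := hA
    obtain ⟨C', s', hC', h'⟩ := hA'
    refine ⟨C + C', s ∪ s', add_nonneg hC hC', fun T ψ φ hψ hφ => ?_⟩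
    rw [add_apply, map_add, inner_add_left, add_mul]
    refine (norm_add_le _ _).trans (add_le_add ((h T ψ φ hψ hφ).trans ?_)
      ((h' T ψ φ hψ hφ).trans ?_))
    · exact mul_le_mul_of_nonneg_left (sup_seminorm_mono Finset.subset_union_left T) hC
    · exact mul_le_mul_of_nonneg_left (sup_seminorm_mono Finset.subset_union_right T) hC'
  | smul c A _ hA =>
    obtain ⟨C, s, hC, h⟩ := hA
    refine ⟨‖c‖ * C, s, mul_nonneg (norm_nonneg c) hC, fun T ψ φ hψ hφ => ?_⟩
    rw [smul_apply, map_smul, inner_smul_left, norm_mul, RCLike.norm_conj, mul_assoc]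
    exact mul_le_mul_of_nonneg_left (h T ψ φ hψ hφ) (norm_nonneg c)

theorem oscillator_pow_hermiteFun (k n : ℕ) :
    (oscillator ^ k) (hermiteFun n) = (((n : ℝ) + 1) ^ k : ℝ) • hermiteFun n := by
  induction k with
  | zero => simp
  | succ k ih =>
    rw [pow_succ', mul_apply_eq_comp, ih, RCLike.real_smul_eq_coe_smul (K := ℂ), map_smul,
      oscillator_hermiteFun, RCLike.real_smul_eq_coe_smul (K := ℂ), smul_smul]
    congr 1
    push_cast
    ring

/-- The vector `T* h_n`, for a Schwartz operator `T`. -/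
def adjointHermite (T : SchwartzOperator) (n : ℕ) : L2R :=
  ContinuousLinearMap.adjoint T.toCLM (incl (hermiteFun n))

theorem inner_adjointHermite (T : SchwartzOperator) (n : ℕ) (x : L2R) :
    ⟪adjointHermite T n, x⟫_ℂ = ⟪incl (hermiteFun n), T.toCLM x⟫_ℂ :=
  ContinuousLinearMap.adjoint_inner_left _ _ _

/-- Schwartz functions are dense in `L²(ℝ)`. The seminorms of an operator test only against them. -/
theorem norm_le_of_inner_incl_le {u : L2R} {K : ℝ} (hK : 0 ≤ K)
    (h : ∀ φ : 𝓢(ℝ, ℂ), ‖incl φ‖ ≤ 1 → ‖⟪u, incl φ⟫_ℂ‖ ≤ K) : ‖u‖ ≤ K := by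
  have h1 : ∀ φ : 𝓢(ℝ, ℂ), ‖⟪u, incl φ⟫_ℂ‖ ≤ K * ‖incl φ‖ := fun φ => by
    rcases eq_or_ne ‖incl φ‖ 0 with h0 | h0
    · rw [norm_eq_zero.mp h0]
      simp
    · have h2 := h ((((‖incl φ‖)⁻¹ : ℝ) : ℂ) • φ) (by
        rw [map_smul, norm_smul, Complex.norm_real, norm_inv, norm_norm, inv_mul_cancel₀ h0])
      rw [map_smul, inner_smul_right, norm_mul, Complex.norm_real, norm_inv, norm_norm,
        inv_mul_le_iff₀ (lt_of_le_of_ne (norm_nonneg _) (Ne.symm h0))] at h2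
      rwa [mul_comm]
  have hd : DenseRange (incl : 𝓢(ℝ, ℂ) → L2R) :=
    SchwartzMap.denseRange_toLpCLM (E := ℝ) (F := ℂ) (p := 2) (μ := volume) (by simp)
  have h3 : ∀ x : L2R, ‖⟪u, x⟫_ℂ‖ ≤ K * ‖x‖ := fun x =>
    hd.induction_on x (isClosed_le (by fun_prop) (by fun_prop)) h1
  have h4 := h3 u
  rw [inner_self_eq_norm_sq_to_K, norm_pow, RCLike.norm_ofReal, abs_norm, sq] at h4
  rcases eq_or_ne ‖u‖ 0 with h0 | h0
  · rw [h0]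
    exact hK
  · exact le_of_mul_le_mul_right h4 (lt_of_le_of_ne (norm_nonneg _) (Ne.symm h0))

/-- Since `h_n` is an eigenvector, `(n+1)^k ⟨h_n, T φ⟩ = ⟨H^k h_n, T φ⟩`, and normal ordering bounds
the right side by seminorms of `T`. -/
theorem exists_bound_adjointHermite (k : ℕ) :
    ∃ (C : ℝ) (s : Finset (ℕ × ℕ × ℕ × ℕ)), 0 ≤ C ∧ ∀ (T : SchwartzOperator) (n : ℕ),
      ((n : ℝ) + 1) ^ k * ‖adjointHermite T n‖ ≤ C * s.sup schwartzOperatorSeminorm T := by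
  obtain ⟨C, s, hC, h⟩ := exists_bound_of_mem_normalOrdered (oscillator_pow_mem k)
  refine ⟨C, s, hC, fun T n => ?_⟩
  have hp : (0 : ℝ) < ((n : ℝ) + 1) ^ k := by positivity
  have hK : 0 ≤ C * s.sup schwartzOperatorSeminorm T := mul_nonneg hC (apply_nonneg _ _)
  rw [mul_comm, ← le_div_iff₀ hp]
  refine norm_le_of_inner_incl_le (div_nonneg hK hp.le) fun φ hφ => ?_
  have h1 := h T (hermiteFun n) φ (orthonormal_hermiteFun.1 n).le hφ
  rw [oscillator_pow_hermiteFun, RCLike.real_smul_eq_coe_smul (K := ℂ), map_smul, inner_smul_left,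
    norm_mul, RCLike.norm_conj, RCLike.norm_ofReal, abs_of_pos hp] at h1
  rw [le_div_iff₀ hp, inner_adjointHermite, mul_comm]
  exact h1

/-- The Hermite expansion of the values of a Schwartz operator. -/
theorem hasSum_toCLM (T : SchwartzOperator) (x : L2R) :
    HasSum (fun n => ⟪adjointHermite T n, x⟫_ℂ • incl (hermiteFun n)) (T.toCLM x) := by
  simp_rw [inner_adjointHermite]
  exact hasSum_hermite _

theorem summable_inv_sq : Summable fun n : ℕ => (((n : ℝ) + 1) ^ 2)⁻¹ := by
  have := (summable_nat_add_iff 1).mpr (Real.summable_nat_pow_inv.mpr one_lt_two)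
  simpa using this

/-- Two further powers of decay are traded for the summable weight `(n + 1)^{-2}`. -/
theorem exists_bound_pairing (t : ℕ) :
    ∃ (C : ℝ) (s : Finset (ℕ × ℕ × ℕ × ℕ)), 0 ≤ C ∧ ∀ (T : SchwartzOperator) (n : ℕ),
      ‖adjointHermite T n‖ * ((n : ℝ) + 1) ^ t ≤
        C * s.sup schwartzOperatorSeminorm T * (((n : ℝ) + 1) ^ 2)⁻¹ := by
  obtain ⟨C, s, hC, h⟩ := exists_bound_adjointHermite (t + 2)
  refine ⟨C, s, hC, fun T n => ?_⟩
  rw [← div_eq_mul_inv, le_div_iff₀ (by positivity)]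
  refine le_trans (le_of_eq ?_) (h T n)
  ring

theorem summable_adjointHermite (T : SchwartzOperator) (t : ℕ) :
    Summable fun n : ℕ => ‖adjointHermite T n‖ * ((n : ℝ) + 1) ^ t := by
  obtain ⟨C, s, -, h⟩ := exists_bound_pairing t
  exact (summable_inv_sq.mul_left _).of_nonneg_of_le (fun n => by positivity) (h T)

/-! ### Distributions and products given by polynomially bounded sequences -/

variable {v : ℕ → L2R} {C : ℝ} {t : ℕ}

theorem summable_norm_mul_norm (hv : ∀ n, ‖v n‖ ≤ C * ((n : ℝ) + 1) ^ t) (T : SchwartzOperator) :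
    Summable fun n => ‖adjointHermite T n‖ * ‖v n‖ := by
  refine ((summable_adjointHermite T t).mul_left C).of_nonneg_of_le (fun n => by positivity)
    fun n => ?_
  calc ‖adjointHermite T n‖ * ‖v n‖ ≤ ‖adjointHermite T n‖ * (C * ((n : ℝ) + 1) ^ t) :=
        mul_le_mul_of_nonneg_left (hv n) (norm_nonneg _)
    _ = _ := by ring

theorem summable_inner_adjointHermite (hv : ∀ n, ‖v n‖ ≤ C * ((n : ℝ) + 1) ^ t)
    (T : SchwartzOperator) : Summable fun n => ⟪adjointHermite T n, v n⟫_ℂ :=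
  Summable.of_norm_bounded (summable_norm_mul_norm hv T) fun _ => norm_inner_le_norm _ _

/-- A polynomially bounded sequence `v` defines the tempered distribution
`T ↦ ∑ n, ⟨h_n, T v_n⟩`. -/
theorem exists_distribution (hv : ∀ n, ‖v n‖ ≤ C * ((n : ℝ) + 1) ^ t) :
    ∃ Λ : TemperedOperatorDistribution, ∀ T, Λ T = ∑' n, ⟪adjointHermite T n, v n⟫_ℂ := by
  let L : SchwartzOperator →ₗ[ℂ] ℂ :=
    { toFun := fun T => ∑' n, ⟪adjointHermite T n, v n⟫_ℂ
      map_add' := fun S T => by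
        rw [← (summable_inner_adjointHermite hv S).tsum_add (summable_inner_adjointHermite hv T)]
        refine tsum_congr fun n => ?_
        rw [inner_adjointHermite, inner_adjointHermite, inner_adjointHermite, map_add, add_apply,
          inner_add_right]
      map_smul' := fun c T => by
        rw [RingHom.id_apply, smul_eq_mul, ← tsum_mul_left]
        refine tsum_congr fun n => ?_
        rw [inner_adjointHermite, inner_adjointHermite, map_smul, smul_apply, inner_smul_right] }
  have hC : 0 ≤ C := by
    have := (norm_nonneg _).trans (hv 0)
    simpa using this
  obtain ⟨D, s, hD, hb⟩ := exists_bound_pairing t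
  set W : ℝ := ∑' n : ℕ, (((n : ℝ) + 1) ^ 2)⁻¹
  have hW : 0 ≤ W := tsum_nonneg fun n => by positivity
  have hL : Continuous L := by
    refine withSeminorms_schwartzOperator.continuous_normedSpace_rng ℂ L
      ⟨s, ⟨C * D * W, by positivity⟩, fun T => ?_⟩
    change ‖∑' n, ⟪adjointHermite T n, v n⟫_ℂ‖ ≤ C * D * W * s.sup schwartzOperatorSeminorm T
    have hs : HasSum (fun n : ℕ => C * (D * s.sup schwartzOperatorSeminorm T) *
        (((n : ℝ) + 1) ^ 2)⁻¹) (C * (D * s.sup schwartzOperatorSeminorm T) * W) :=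
      summable_inv_sq.hasSum.mul_left _
    refine (tsum_of_norm_bounded hs fun n => (norm_inner_le_norm _ _).trans ?_).trans_eq ?_
    · calc ‖adjointHermite T n‖ * ‖v n‖ ≤ ‖adjointHermite T n‖ * (C * ((n : ℝ) + 1) ^ t) :=
            mul_le_mul_of_nonneg_left (hv n) (norm_nonneg _)
        _ = C * (‖adjointHermite T n‖ * ((n : ℝ) + 1) ^ t) := by ring
        _ ≤ C * (D * s.sup schwartzOperatorSeminorm T * (((n : ℝ) + 1) ^ 2)⁻¹) :=
            mul_le_mul_of_nonneg_left (hb T n) hC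
        _ = _ := by ring
    · ring
  exact ⟨⟨L, hL⟩, fun T => rfl⟩

/-- The range of a Schwartz operator consists of Schwartz functions, with Hermite expansions
converging in the Schwartz space. -/
theorem exists_hasSum_hermiteFun (T : SchwartzOperator) (φ : L2R) :
    ∃ η : 𝓢(ℝ, ℂ), HasSum (fun n => ⟪adjointHermite T n, φ⟫_ℂ • hermiteFun n) η := by
  refine exists_hasSum_schwartz fun k l => ?_
  obtain ⟨C, t, hC, h⟩ := exists_bound_seminorm_hermiteFun k l
  refine ((summable_adjointHermite T t).mul_left (C * ‖φ‖)).of_nonneg_of_le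
    (fun n => apply_nonneg _ _) fun n => ?_
  rw [map_smul_eq_mul]
  calc ‖⟪adjointHermite T n, φ⟫_ℂ‖ * SchwartzMap.seminorm ℂ k l (hermiteFun n)
      ≤ (‖adjointHermite T n‖ * ‖φ‖) * (C * ((n : ℝ) + 1) ^ t) :=
        mul_le_mul (norm_inner_le_norm _ _) (h n) (apply_nonneg _ _) (by positivity)
    _ = _ := by ring

theorem norm_evalPoly_hermiteFun_le (f : FreeAlgebra ℂ (Fin 2)) :
    ∃ C t, 0 ≤ C ∧ ∀ n : ℕ, ‖incl (evalPoly f position momentum (hermiteFun n))‖ ≤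
      C * ((n : ℝ) + 1) ^ t := by
  obtain ⟨C, t, hC, h⟩ := exists_bound_evalPoly f
  refine ⟨C, t, hC, fun n => ?_⟩
  have h1 := h (Finsupp.single n 1)
  rwa [hermiteComb_single, one_smul, weightedNorm_single, norm_one, mul_one] at h1

/-- The Hermite series of `T φ` converges in the Schwartz space, where `f(Q, P)` is continuous;
uniqueness of sums in `L²(ℝ)` then identifies both images. -/
theorem isPolyMul_of_hasSum (f : FreeAlgebra ℂ (Fin 2)) (T : SchwartzOperator)
    {B : L2R →L[ℂ] L2R} (hB : ∀ x, HasSum (fun n => ⟪adjointHermite T n, x⟫_ℂ •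
      incl (evalPoly f position momentum (hermiteFun n))) (B x)) : IsPolyMul f T.toCLM B := by
  intro φ
  obtain ⟨η, hη⟩ := exists_hasSum_hermiteFun T φ
  refine ⟨η, ?_, ?_⟩
  · refine HasSum.unique ?_ (hasSum_toCLM T φ)
    simpa only [map_smul] using incl.hasSum hη
  · refine HasSum.unique ?_ (hB φ)
    simpa only [map_smul] using incl.hasSum ((evalPoly f position momentum).hasSum hη)

end SchwartzOperators

end FluctuationOperators

end

theorem mainTheorem11 (f : FreeAlgebra ℂ (Fin 2)) :
    ∃ (fQPmul : SchwartzOperator → (L2R →L[ℂ] L2R))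
      (Φ : ℕ → TemperedOperatorDistribution) (Ψ : TemperedOperatorDistribution),
      (∀ T : SchwartzOperator, IsPolyMul f T.toCLM (fQPmul T)) ∧
      (∀ T : SchwartzOperator, IsTraceClass (fQPmul T)) ∧
      (∀ (M : ℕ) (T : SchwartzOperator), IsTraceClass (evalPoly f (fluctQ M) (fluctP M) * T.toCLM)) ∧
      (∀ T : SchwartzOperator, Ψ T = trace (fQPmul T)) ∧
      (∀ (M : ℕ) (T : SchwartzOperator), Φ M T = trace (evalPoly f (fluctQ M) (fluctP M) * T.toCLM)) ∧
      Tendsto Φ atTop (𝓝 Ψ) ∧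
      ∀ T : SchwartzOperator,
        Tendsto (fun M : ℕ => trace (evalPoly f (fluctQ M) (fluctP M) * T.toCLM)) atTop
          (𝓝 (trace (fQPmul T))) := by
  obtain ⟨C, t, hC, hv⟩ := norm_evalPoly_hermiteFun_le f
  obtain ⟨C', t', hC', hv'⟩ := exists_bound_evalPoly_fluct f
  -- The product `f(Q, P) T` is constructed as `∑ |f(Q, P) h_n⟩⟨T* h_n|`.
  choose B hB using fun T : SchwartzOperator =>
    exists_clm_hasSum_rankOne (summable_norm_mul_norm hv T)
  obtain ⟨Ψ, hΨ⟩ := exists_distribution hv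
  choose Φ hΦ using fun M => exists_distribution (hv' M)
  have hA : ∀ (M : ℕ) (T : SchwartzOperator) (x : L2R),
      HasSum (fun n => ⟪adjointHermite T n, x⟫_ℂ •
        evalPoly f (fluctQ M) (fluctP M) (incl (hermiteFun n)))
        ((evalPoly f (fluctQ M) (fluctP M) * T.toCLM) x) := fun M T x => by
    rw [mul_apply_eq_comp]
    simpa only [map_smul] using (evalPoly f (fluctQ M) (fluctP M)).hasSum (hasSum_toCLM T x)
  have hΨT : ∀ T, Ψ T = trace (B T) := fun T => by
    rw [hΨ, trace_eq_tsum (summable_norm_mul_norm hv T) (hB T)]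
  have hΦT : ∀ M T, Φ M T = trace (evalPoly f (fluctQ M) (fluctP M) * T.toCLM) := fun M T => by
    rw [hΦ, trace_eq_tsum (summable_norm_mul_norm (hv' M) T) (hA M T)]
  have hlim : ∀ T, Tendsto (fun M => Φ M T) atTop (𝓝 (Ψ T)) := fun T => by
    simp_rw [hΦ, hΨ]
    -- The terms converge for each `n`, and the rapid decay of `T* h_n` dominates the polynomial
    -- bound uniformly in `M`.
    refine tendsto_tsum_of_dominated_convergence
      ((summable_adjointHermite T t').mul_left C') (fun n => ?_)
      (Eventually.of_forall fun M n => ?_)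
    · exact ((innerSL ℂ (adjointHermite T n)).continuous.tendsto _).comp
        (tendsto_evalPoly_fluct f n)
    · calc ‖⟪adjointHermite T n, evalPoly f (fluctQ M) (fluctP M) (incl (hermiteFun n))⟫_ℂ‖
          ≤ ‖adjointHermite T n‖ * (C' * ((n : ℝ) + 1) ^ t') :=
            (norm_inner_le_norm _ _).trans (mul_le_mul_of_nonneg_left (hv' M n) (norm_nonneg _))
        _ = C' * (‖adjointHermite T n‖ * ((n : ℝ) + 1) ^ t') := by ring
  refine ⟨B, Φ, Ψ, fun T => isPolyMul_of_hasSum f T (hB T),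
    fun T => isTraceClass_of_hasSum (summable_norm_mul_norm hv T) (hB T),
    fun M T => isTraceClass_of_hasSum (summable_norm_mul_norm (hv' M) T) (hA M T),
    hΨT, hΦT, tendsto_iff_forall_eval_tendsto_topDualPairing.mpr hlim, fun T => ?_⟩
  simp_rw [← hΦT, ← hΨT]
  exact hlim T
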